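/- Let $\lambda>0$, $\alpha>2$, $\ell\in[0,1]$, $c_1,c_2>0$, and $\rho(\theta)=\frac{1}{1+c_2e^{-c_1\theta}}$. Let $\Phi_x=\{X_i: i\ge 1\}$ be a homogeneous Poisson point process of density $\lambda$ on $\mathbb{R}^2$. For each $i$ let $\Theta_i\in[0,\frac{\pi}{2}]$ be the elevation angle, seen from the origin, of the point $U_i=(X_i,H_i)$ with projection $X_i$ and altitude $H_i=\|X_i\|\tan\Theta_i\ge 0$, so that $\|U_i\|=\|X_i\|\sec\Theta_i$ (a point with $\Theta_i=\frac{\pi}{2}$ is at infinite distance and contributes $0$ below). Given all the points $U_j$, the links from the origin to the points are independently line-of-sight (LoS), the $i$-th one with probability $\rho(\Theta_i)$; put $L_i=1$ if it is LoS and $L_i=\ell$ otherwise. Let the weights $W_i\ge 0$ be i.i.d. copies of a random variable $W$ with $\mathbb{E}[W^{2/\alpha}]<\infty$, jointly independent of all the $U_j$ and $L_j$. Write $\mathcal{L}_Z(s)=\mathbb{E}[e^{-sZ}]$ for the Laplace transform of a random variable $Z\ge 0$, and let $$T_0=\sum_{i\ge 1}W_iL_i\|U_i\|^{-\alpha}.$$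 (i) (APIL scenario.) Suppose that the angles $\Theta_i$ are i.i.d. copies of a random variable $\Theta$ and that $(\Theta_i)_i$ is independent of $(X_i)_i$. Then $T_0<\infty$ almost surely, and for all $s>0$ $$\mathcal{L}_{T_0}(s)=\exp\left\{-\pi\lambda\, s^{2/\alpha}\,\mathbb{E}\left[W^{2/\alpha}\right]\Gamma\left(1-\tfrac{2}{\alpha}\right)\omega\right\},\qquad \omega=\mathbb{E}\left\{\cos^2(\Theta)\left[\rho(\Theta)\left(1-\ell^{2/\alpha}\right)+\ell^{2/\alpha}\right]\right\}.$$ (ii) (APDL scenario.) Suppose that the altitudes $H_i$ are i.i.d. copies of a random variable $H\in[0,\infty)$, that $(H_i)_i$ is independent of $(X_i)_i$, and that $\Theta_i=\tan^{-1}(H_i/\|X_i\|)$. Then $T_0<\infty$ almost surely, and for all $s>0$ $$\mathcal{L}_{T_0}(s)=\exp\left(-\pi\lambda\int_0^\infty\mathcal{J}_W\left(sz^{-\alpha/2},\tan^{-1}\left(\tfrac{H}{\sqrt z}\right)\right)dz\right),$$ where the integrand is integrable and, for $x>0$ and a random angle $Y$, $$\mathcal{J}_W(x,Y)=\mathbb{E}_Y\left\{\rho(Y)\left[1-\mathcal{L}_W\left(x\cos^\alpha(Y)\right)\right]+\left[1-\rho(Y)\right]\left[1-\mathcal{L}_W\left(x\ell\cos^\alpha(Y)\right)\right]\right\}.$$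 -/

import Mathlib

open MeasureTheory ProbabilityTheory Set
open scoped ENNReal NNReal

/-- The ground plane, with its Euclidean norm and Lebesgue measure. -/
abbrev Plane : Type := EuclideanSpace ℝ (Fin 2)

/-- The number of indices `i` for which the point `X i` lies in `B`. -/
noncomputable def pointCount {Ω : Type*} (X : ℕ → Ω → Plane) (B : Set Plane) (ω : Ω) : ℕ∞ :=
  {i : ℕ | X i ω ∈ B}.encard

/-- The random points `X 0, X 1, …` form a homogeneous Poisson point process on the plane of
density `lam`: the number of points in a Borel set of finite area is Poisson with mean `lam` times
the area, and the numbers of points in disjoint sets are independent. Points are counted with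
multiplicity, so that such a process is automatically simple (almost surely no two of the points
coincide). -/
structure IsHomogeneousPPP {Ω : Type*} [MeasurableSpace Ω] (μ : Measure Ω) (lam : ℝ≥0)
    (X : ℕ → Ω → Plane) : Prop where
  measurable_point : ∀ i, Measurable (X i)
  poisson_count : ∀ B : Set Plane, MeasurableSet B → volume B < ∞ → ∀ n : ℕ,
    μ {ω | pointCount X B ω = n} = poissonMeasure (lam * (volume B).toNNReal) {n}
  indep_count : ∀ (k : ℕ) (B : Fin k → Set Plane), (∀ j, MeasurableSet (B j)) →
    (∀ j, volume (B j) < ∞) → Pairwise (fun j j' => Disjoint (B j) (B j')) →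
    iIndepFun (fun j => pointCount X (B j)) μ

/-- The line-of-sight (LoS) probability at elevation angle `θ`. -/
noncomputable def losProb (c₁ c₂ θ : ℝ) : ℝ := 1 / (1 + c₂ * Real.exp (-c₁ * θ))

/-- The channel factor `L ∈ {1, ℓ}`: `1` for a LoS link, `ℓ` otherwise. -/
def channelGain (ℓ : ℝ) (los : Bool) : ℝ := if los then 1 else ℓ

/-- The tangent on `[0, π/2]` with values in `[0, ∞]`; in particular `tan (π/2) = ∞`. -/
noncomputable def extTan (θ : ℝ) : ℝ≥0∞ := ENNReal.ofReal (Real.sin θ) / ENNReal.ofReal (Real.cos θ)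

/-- The distance to the origin of the point of space with projection `x` and altitude `h`. -/
noncomputable def spaceNorm (x : Plane) (h : ℝ≥0∞) : ℝ≥0∞ :=
  (ENNReal.ofReal ‖x‖ ^ 2 + h ^ 2) ^ (1 / 2 : ℝ)

/-- The shot signal process `T₀ = ∑ i, W i * L i * ‖U i‖ ^ (-α)`, where `U i` is the point with
projection `X i` and altitude `A i`, and `L i` is the channel factor given by `los i`. -/
noncomputable def shotSignal {Ω : Type*} (α ℓ : ℝ) (X : ℕ → Ω → Plane) (A : ℕ → Ω → ℝ≥0∞)
    (los : ℕ → Ω → Bool) (W : ℕ → Ω → ℝ≥0) (ω : Ω) : ℝ≥0∞ :=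
  ∑' i, (W i ω : ℝ≥0∞) * ENNReal.ofReal (channelGain ℓ (los i ω)) *
    spaceNorm (X i ω) (A i ω) ^ (-α)

/-- The Laplace transform `s ↦ 𝔼[exp (-s Z)]` of a nonnegative random variable. -/
noncomputable def laplaceTransform {Ω : Type*} [MeasurableSpace Ω] (μ : Measure Ω) (Z : Ω → ℝ)
    (s : ℝ) : ℝ := ∫ ω, Real.exp (-s * Z ω) ∂μ

/-- The common part of both scenarios, with projections `X`, elevation angles `Θ`, LoS indicators
`los` and weights `W`. -/
structure IsShotModel {Ω : Type*} [MeasurableSpace Ω] (μ : Measure Ω) (lam : ℝ≥0) (c₁ c₂ : ℝ)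
    (X : ℕ → Ω → Plane) (Θ : ℕ → Ω → ℝ) (los : ℕ → Ω → Bool) (W : ℕ → Ω → ℝ≥0) : Prop where
  /-- The projections form a homogeneous Poisson point process of density `lam`. -/
  ppp : IsHomogeneousPPP μ lam X
  measurable_angle : ∀ i, Measurable (Θ i)
  angle_mem : ∀ i, ∀ᵐ ω ∂μ, Θ i ω ∈ Icc 0 (Real.pi / 2)
  measurable_los : ∀ i, Measurable (los i)
  measurable_weight : ∀ i, Measurable (W i)
  /-- Given the locations of all points, the links are LoS independently of each other, the `i`-th
  one with probability `losProb c₁ c₂ (Θ i)`. -/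
  los_cond : ∀ F : Finset ℕ,
    μ⟦⋂ i ∈ F, {ω | los i ω = true} |
        MeasurableSpace.comap (fun ω (i : ℕ) => (X i ω, Θ i ω)) inferInstance⟧
      =ᵐ[μ] fun ω => ∏ i ∈ F, losProb c₁ c₂ (Θ i ω)
  /-- The weights are i.i.d. … -/
  weight_indep : iIndepFun W μ
  weight_ident : ∀ i, IdentDistrib (W i) (W 0) μ μ
  /-- … and independent of all the locations and LoS indicators. -/
  weight_indep_rest : IndepFun (fun ω (i : ℕ) => W i ω)
    (fun ω (i : ℕ) => (X i ω, Θ i ω, los i ω)) μ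

/-- The angle-projection-independent scenario: the elevation angles are i.i.d. and independent of
the projections. -/
structure IsAPIL {Ω : Type*} [MeasurableSpace Ω] (μ : Measure Ω)
    (X : ℕ → Ω → Plane) (Θ : ℕ → Ω → ℝ) : Prop where
  angle_indep : iIndepFun Θ μ
  angle_ident : ∀ i, IdentDistrib (Θ i) (Θ 0) μ μ
  angle_indep_projection : IndepFun (fun ω (i : ℕ) => Θ i ω) (fun ω (i : ℕ) => X i ω) μ

/-- The altitude `‖X i‖ * tan (Θ i)` determined by the projection and the elevation angle. -/
noncomputable def altitude {Ω : Type*} (X : ℕ → Ω → Plane) (Θ : ℕ → Ω → ℝ) (i : ℕ) (ω : Ω) :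
    ℝ≥0∞ := ENNReal.ofReal ‖X i ω‖ * extTan (Θ i ω)

/-- The angle-projection-dependent scenario: the altitudes `H` are i.i.d. and independent of the
projections, and the elevation angles are determined by both. -/
structure IsAPDL {Ω : Type*} [MeasurableSpace Ω] (μ : Measure Ω)
    (X : ℕ → Ω → Plane) (Θ : ℕ → Ω → ℝ) (H : ℕ → Ω → ℝ≥0) : Prop where
  measurable_altitude : ∀ i, Measurable (H i)
  altitude_indep : iIndepFun H μ
  altitude_ident : ∀ i, IdentDistrib (H i) (H 0) μ μ
  altitude_indep_projection : IndepFun (fun ω (i : ℕ) => H i ω) (fun ω (i : ℕ) => X i ω) μ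
  angle_eq : ∀ i, ∀ᵐ ω ∂μ, Θ i ω = Real.arctan ((H i ω : ℝ) / ‖X i ω‖)

/-- The constant `ω = 𝔼[cos² Θ (ρ(Θ) (1 - ℓ^(2/α)) + ℓ^(2/α))]`. -/
noncomputable def omegaConst {Ω : Type*} [MeasurableSpace Ω] (μ : Measure Ω) (α ℓ c₁ c₂ : ℝ)
    (Θ : Ω → ℝ) : ℝ :=
  ∫ ω, Real.cos (Θ ω) ^ 2 *
    (losProb c₁ c₂ (Θ ω) * (1 - ℓ ^ (2 / α)) + ℓ ^ (2 / α)) ∂μ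

/-- `J_W(x, Y) = 𝔼_Y[ρ(Y) (1 - L_W(x cos^α Y)) + (1 - ρ(Y)) (1 - L_W(x ℓ cos^α Y))]`, where the
expectation is over the random angle `Y` and `L_W` is the Laplace transform of `W`. -/
noncomputable def JFun {Ω : Type*} [MeasurableSpace Ω] (μ : Measure Ω) (α ℓ c₁ c₂ : ℝ)
    (W : Ω → ℝ≥0) (x : ℝ) (Y : Ω → ℝ) : ℝ :=
  ∫ ω, (losProb c₁ c₂ (Y ω) *
      (1 - laplaceTransform μ (fun ω' => (W ω' : ℝ)) (x * Real.cos (Y ω) ^ α)) +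
    (1 - losProb c₁ c₂ (Y ω)) *
      (1 - laplaceTransform μ (fun ω' => (W ω' : ℝ)) (x * ℓ * Real.cos (Y ω) ^ α))) ∂μ

/-! Write `exp (-s T₀)` as the limit of its finite partial products and integrate out the randomness
in layers. The weights are i.i.d. and independent of everything else, so integrating them replaces
each factor by a value of the Laplace transform of `W`. Given the locations, the LoS indicators are
independent, so integrating them leaves `1 - linkLoss` at each point (`integral_prod_link`). In both
scenarios the angle is a function `τ` of the projection and of an i.i.d. mark independent of all
projections: the mark is the angle itself, or the altitude. Averaging over the marks gives factors
`1 - u (X i)`, where `u x` is the mean loss of a link with projection `x`. The Laplace functional of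
the Poisson process turns the limit of the products into `exp (-λ ∫ u)`.

Two estimates make this rigorous. Every loss is at most `1 - L_W (s ‖x‖ ^ (-α))`, and the plane
integral of this bound is `π s ^ (2/α) 𝔼[W ^ (2/α)] Γ(1 - 2/α)`, finite because `α > 2`; hence `u`
is integrable whatever the angles are. The identity is first proved with `expNeg`, which sends `∞`
to `0`, so it needs no finiteness of `T₀`. Letting `s → 0` in it then shows that `T₀ < ∞` almost
surely.

It remains to evaluate `∫ u`. For angles independent of the projections, Fubini and scaling produce
the constant `omegaConst`; for given altitudes, the substitution `z = ‖x‖²` produces the integral of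
`JFun`. -/

open Filter Topology

/-! ### The exponential on `[0, ∞]` and limits of integrals of `[0, 1]`-valued functions -/

/-- The function `t ↦ exp (-t)` on `[0, ∞]`, with `exp (-∞) = 0`. -/
noncomputable def expNeg (t : ℝ≥0∞) : ℝ := (EReal.exp (-(t : EReal))).toReal

lemma expNeg_arg_ne_top (t : ℝ≥0∞) : EReal.exp (-(t : EReal)) ≠ ∞ := by
  have h : EReal.exp (-(t : EReal)) ≤ 1 := by simp [EReal.coe_ennreal_nonneg]
  exact ne_top_of_le_ne_top (by simp) h

/-- Continuity includes the point `∞`, so limits of partial sums pass through `expNeg` even where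
the sum diverges. -/
lemma continuous_expNeg : Continuous expNeg := by
  refine ENNReal.continuousOn_toReal.comp_continuous ?_ expNeg_arg_ne_top
  have h1 : Continuous (EReal.exp) := EReal.expHomeomorph.continuous
  exact h1.comp (continuous_neg.comp continuous_coe_ennreal_ereal)

lemma measurable_expNeg : Measurable expNeg := continuous_expNeg.measurable

lemma expNeg_nonneg (t : ℝ≥0∞) : 0 ≤ expNeg t := ENNReal.toReal_nonneg

lemma expNeg_le_one (t : ℝ≥0∞) : expNeg t ≤ 1 := by
  have h : EReal.exp (-(t : EReal)) ≤ 1 := by simp [EReal.coe_ennreal_nonneg]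
  simpa [expNeg] using ENNReal.toReal_mono (by simp) h

@[simp] lemma expNeg_zero : expNeg 0 = 1 := by simp [expNeg]

@[simp] lemma expNeg_top : expNeg ∞ = 0 := by simp [expNeg]

lemma expNeg_antitone : Antitone expNeg := by
  intro a b hab
  refine ENNReal.toReal_mono (expNeg_arg_ne_top _) ?_
  exact EReal.exp_monotone (EReal.neg_le_neg_iff.2 (by exact_mod_cast hab))

lemma expNeg_add (a b : ℝ≥0∞) : expNeg (a + b) = expNeg a * expNeg b := by
  rw [expNeg, expNeg, expNeg, ← ENNReal.toReal_mul, ← EReal.exp_add, EReal.coe_ennreal_add,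
    EReal.neg_add (by simp) (by simp)]
  rfl

lemma expNeg_sum {ι : Type*} (s : Finset ι) (f : ι → ℝ≥0∞) :
    expNeg (∑ i ∈ s, f i) = ∏ i ∈ s, expNeg (f i) := by
  classical
  induction s using Finset.induction_on with
  | empty => simp
  | insert a s ha ih => rw [Finset.sum_insert ha, Finset.prod_insert ha, expNeg_add, ih]

lemma expNeg_ofReal {x : ℝ} (hx : 0 ≤ x) : expNeg (ENNReal.ofReal x) = Real.exp (-x) := by
  rw [expNeg, EReal.coe_ennreal_ofReal, max_eq_left hx, ← EReal.coe_neg, EReal.exp_coe,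
    ENNReal.toReal_ofReal (Real.exp_pos _).le]

lemma expNeg_of_ne_top {t : ℝ≥0∞} (ht : t ≠ ∞) : expNeg t = Real.exp (-t.toReal) := by
  rw [← expNeg_ofReal ENNReal.toReal_nonneg, ENNReal.ofReal_toReal ht]

lemma expNeg_nsmul (n : ℕ) (a : ℝ≥0∞) : expNeg (a * n) = expNeg a ^ n := by
  have := expNeg_sum (Finset.range n) (fun _ => a)
  simpa [mul_comm] using this

lemma integrable_of_mem_Icc {Ω : Type*} [MeasurableSpace Ω] {μ : Measure Ω} [IsFiniteMeasure μ]
    {f : Ω → ℝ} (hf : Measurable f) (h0 : ∀ ω, 0 ≤ f ω) (h1 : ∀ ω, f ω ≤ 1) : Integrable f μ :=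
  Integrable.of_bound hf.aestronglyMeasurable 1 (ae_of_all _ fun ω => by
    rw [Real.norm_eq_abs, abs_of_nonneg (h0 ω)]; exact h1 ω)

lemma tendsto_integral_of_mem_Icc {Ω : Type*} [MeasurableSpace Ω] {μ : Measure Ω}
    [IsFiniteMeasure μ] {F : ℕ → Ω → ℝ} {f : Ω → ℝ} (hF : ∀ n, Measurable (F n))
    (h0 : ∀ n ω, 0 ≤ F n ω) (h1 : ∀ n ω, F n ω ≤ 1)
    (hlim : ∀ᵐ ω ∂μ, Tendsto (fun n => F n ω) atTop (𝓝 (f ω))) :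
    Tendsto (fun n => ∫ ω, F n ω ∂μ) atTop (𝓝 (∫ ω, f ω ∂μ)) := by
  refine tendsto_integral_of_dominated_convergence (fun _ => 1)
    (fun n => (hF n).aestronglyMeasurable) (integrable_const _) (fun n => ae_of_all _ fun ω => ?_)
    hlim
  rw [Real.norm_eq_abs, abs_of_nonneg (h0 n ω)]
  exact h1 n ω

/-! ### Poisson counts and the Laplace functional -/

lemma integral_pow_poissonMeasure (r : ℝ≥0) (q : ℝ) (h0 : 0 ≤ q) (h1 : q ≤ 1) :
    ∫ n, q ^ n ∂(poissonMeasure r) = Real.exp (-(r * (1 - q))) := by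
  have hint : Integrable (fun n : ℕ => q ^ n) (poissonMeasure r) :=
    integrable_of_mem_Icc (measurable_of_countable _) (fun n => by positivity)
      (fun n => pow_le_one₀ h0 h1)
  rw [integral_poissonMeasure' hint]
  have h : ∀ n : ℕ, (Real.exp (-r) * (r : ℝ) ^ n / (n.factorial : ℝ)) • q ^ n
      = Real.exp (-r) * ((r * q) ^ n / (n.factorial : ℝ)) := by
    intro n
    rw [smul_eq_mul, mul_pow]; ring
  simp_rw [h]
  have hs : HasSum (fun n : ℕ => (r * q) ^ n / (n.factorial : ℝ)) (Real.exp (r * q)) := by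
    rw [Real.exp_eq_exp_ℝ]
    exact NormedSpace.expSeries_div_hasSum_exp ((r : ℝ) * q)
  rw [tsum_mul_left, hs.tsum_eq, ← Real.exp_add]
  congr 1; ring

/-- The sum is an integral against the image of counting measure under `i ↦ X i ω`, whose mass on a
set is the number of points there. -/
lemma tsum_simpleFunc_eq {Ω : Type*} (X : ℕ → Ω → Plane) (f : SimpleFunc Plane ℝ≥0∞) (ω : Ω) :
    ∑' i, f (X i ω) =
      ∑ c ∈ f.range, c * (pointCount X (f ⁻¹' {c}) ω : ℝ≥0∞) := by
  have hm : Measurable (fun i => X i ω) := measurable_of_countable _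
  rw [← lintegral_count, ← lintegral_map f.measurable hm, SimpleFunc.lintegral_eq_lintegral,
    SimpleFunc.lintegral]
  refine Finset.sum_congr rfl fun c _ => ?_
  rw [Measure.map_apply hm (f.measurableSet_fiber c), Measure.count_apply (hm (f.measurableSet_fiber c))]
  rfl

section LaplaceFunctional

variable {Ω : Type*} [MeasurableSpace Ω] {μ : Measure Ω} {lam : ℝ≥0} {X : ℕ → Ω → Plane}

lemma IsHomogeneousPPP.measurable_pointCount (hX : IsHomogeneousPPP μ lam X) {B : Set Plane}
    (hB : MeasurableSet B) : Measurable (pointCount X B) := by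
  refine measurable_encard.comp ?_
  refine measurable_set_iff.2 fun i => ?_
  exact measurableSet_setOfPred.1 (hX.measurable_point i hB)

lemma IsHomogeneousPPP.map_pointCount [IsProbabilityMeasure μ] (hX : IsHomogeneousPPP μ lam X)
    {B : Set Plane} (hB : MeasurableSet B) (hvol : volume B < ∞) :
    μ.map (pointCount X B) =
      (poissonMeasure (lam * (volume B).toNNReal)).map (fun n : ℕ => (n : ℕ∞)) := by
  have hm := hX.measurable_pointCount hB
  set P := (poissonMeasure (lam * (volume B).toNNReal)).map (fun n : ℕ => (n : ℕ∞)) with hP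
  have hc : Measurable (fun n : ℕ => (n : ℕ∞)) := measurable_of_countable _
  have : IsProbabilityMeasure (μ.map (pointCount X B)) :=
    Measure.isProbabilityMeasure_map hm.aemeasurable
  have : IsProbabilityMeasure P := Measure.isProbabilityMeasure_map hc.aemeasurable
  have hn : ∀ n : ℕ, μ.map (pointCount X B) {(n : ℕ∞)} = P {(n : ℕ∞)} := by
    intro n
    rw [Measure.map_apply hm (measurableSet_singleton _), hP,
      Measure.map_apply hc (measurableSet_singleton _)]
    have h2 : (fun n : ℕ => (n : ℕ∞)) ⁻¹' {(n : ℕ∞)} = {n} := by ext; simp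
    rw [h2]
    exact hX.poisson_count B hB hvol n
  have hu : (⋃ n : ℕ, {(n : ℕ∞)}) = ({⊤} : Set ℕ∞)ᶜ := by
    ext x
    induction x using ENat.recTopCoe <;> simp
  -- The hypothesis on counts concerns finite values only; the mass at `⊤` is what these leave of
  -- the total mass one.
  have htop : μ.map (pointCount X B) {⊤} = P {⊤} := by
    have key : ∀ Q : Measure ℕ∞, IsProbabilityMeasure Q →
        Q {⊤} = 1 - ∑' n : ℕ, Q {(n : ℕ∞)} := by
      intro Q _
      rw [← measure_iUnion (fun i j hij => by simpa using hij) (fun _ => measurableSet_singleton _),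
        hu, ← prob_compl_eq_one_sub (measurableSet_singleton _).compl, compl_compl]
    rw [key _ inferInstance, key P inferInstance]
    simp_rw [hn]
  refine Measure.ext_of_singleton fun x => ?_
  induction x using ENat.recTopCoe with
  | top => exact htop
  | coe n => exact hn n

lemma IsHomogeneousPPP.integral_expNeg_pointCount [IsProbabilityMeasure μ]
    (hX : IsHomogeneousPPP μ lam X)
    {B : Set Plane} (hB : MeasurableSet B) (hvol : volume B < ∞) (c : ℝ≥0∞) :
    ∫ ω, expNeg (c * (pointCount X B ω : ℝ≥0∞)) ∂μ =
      expNeg (lam * (ENNReal.ofReal (1 - expNeg c) * volume B)) := by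
  have hc : Measurable (fun n : ℕ => (n : ℕ∞)) := measurable_of_countable _
  rw [← integral_map (f := fun n : ℕ∞ => expNeg (c * (n : ℝ≥0∞)))
      (hX.measurable_pointCount hB).aemeasurable
      (measurable_of_countable _).aestronglyMeasurable, hX.map_pointCount hB hvol,
    integral_map hc.aemeasurable (measurable_of_countable _).aestronglyMeasurable]
  simp only [ENat.toENNReal_coe, expNeg_nsmul]
  rw [integral_pow_poissonMeasure _ _ (expNeg_nonneg c) (expNeg_le_one c),
    expNeg_of_ne_top (ENNReal.mul_ne_top (by simp) (ENNReal.mul_ne_top (by simp) hvol.ne))]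
  · congr 1
    rw [ENNReal.toReal_mul, ENNReal.toReal_mul,
      ENNReal.toReal_ofReal (sub_nonneg.2 (expNeg_le_one c))]
    simp only [NNReal.coe_mul, ENNReal.coe_toReal, ENNReal.coe_toNNReal_eq_toReal]
    ring

/-- The level sets of `f` are disjoint, so their counts are independent Poisson variables and the
expectation factors. The value `0` is discarded on both sides: it contributes nothing, and its level
set may have infinite area. -/
lemma IsHomogeneousPPP.laplace_simpleFunc [IsProbabilityMeasure μ] (hX : IsHomogeneousPPP μ lam X)
    (f : SimpleFunc Plane ℝ≥0∞) (hf : ∀ c ≠ 0, volume (f ⁻¹' {c}) < ∞) :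
    ∫ ω, expNeg (∑' i, f (X i ω)) ∂μ =
      expNeg (lam * ∫⁻ x, ENNReal.ofReal (1 - expNeg (f x))) := by
  classical
  set S := f.range.filter (· ≠ 0) with hS
  have hlhs : ∀ ω, expNeg (∑' i, f (X i ω)) =
      ∏ c : S, expNeg (c * (pointCount X (f ⁻¹' {(c : ℝ≥0∞)}) ω : ℝ≥0∞)) := by
    intro ω
    rw [tsum_simpleFunc_eq, ← expNeg_sum, Finset.sum_coe_sort S
      (fun c => c * (pointCount X (f ⁻¹' {c}) ω : ℝ≥0∞)), hS, Finset.sum_filter_of_ne]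
    intro c _ h hc
    simp [hc] at h
  have hrhs : ∫⁻ x, ENNReal.ofReal (1 - expNeg (f x)) =
      ∑ c : S, ENNReal.ofReal (1 - expNeg c) * volume (f ⁻¹' {(c : ℝ≥0∞)}) := by
    rw [Finset.sum_coe_sort S (fun c => ENNReal.ofReal (1 - expNeg c) * volume (f ⁻¹' {c})), hS,
      Finset.sum_filter_of_ne, ← SimpleFunc.map_lintegral, ← SimpleFunc.lintegral_eq_lintegral]
    · rfl
    · intro c _ h hc
      simp [hc] at h
  have hvol : ∀ c : S, volume (f ⁻¹' {(c : ℝ≥0∞)}) < ∞ := fun c => hf _ (by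
    have := c.2; simp only [hS, Finset.mem_filter] at this; exact this.2)
  have hind : iIndepFun (fun c : S => pointCount X (f ⁻¹' {(c : ℝ≥0∞)})) μ := by
    have := (hX.indep_count _ (fun j => f ⁻¹' {((S.equivFin.symm j : S) : ℝ≥0∞)})
      (fun j => f.measurableSet_fiber _) (fun j => hvol _) (fun i j hij => by
        refine Disjoint.preimage _ ?_
        simpa [Subtype.ext_iff] using hij)).precomp S.equivFin.injective
    simpa using this
  simp_rw [hlhs]
  rw [hind.integral_fun_prod_comp (f := fun (c : S) (n : ℕ∞) => expNeg (c * (n : ℝ≥0∞)))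
    (fun c => (hX.measurable_pointCount (f.measurableSet_fiber _)).aemeasurable)
    (fun c => (measurable_of_countable _).aestronglyMeasurable), hrhs, Finset.mul_sum, expNeg_sum]
  exact Finset.prod_congr rfl fun c _ =>
    hX.integral_expNeg_pointCount (f.measurableSet_fiber _) (hvol c) _

/-- The Laplace functional of a homogeneous Poisson point process. -/
theorem IsHomogeneousPPP.laplace [IsProbabilityMeasure μ] (hX : IsHomogeneousPPP μ lam X)
    {f : Plane → ℝ≥0∞} (hf : Measurable f) :
    ∫ ω, expNeg (∑' i, f (X i ω)) ∂μ =
      expNeg (lam * ∫⁻ x, ENNReal.ofReal (1 - expNeg (f x))) := by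
  -- Restricting the simple approximations to growing balls gives the nonzero level sets finite area
  -- and keeps the sequence increasing to `f`.
  set g : ℕ → SimpleFunc Plane ℝ≥0∞ := fun n =>
    (SimpleFunc.eapprox f n).restrict (Metric.ball 0 n) with hg
  have hgv : ∀ n x, g n x = (Metric.ball (0 : Plane) n).indicator (SimpleFunc.eapprox f n) x :=
    fun n x => by rw [hg]; simp only [SimpleFunc.restrict_apply _ Metric.isOpen_ball.measurableSet]
  have hmono : ∀ x, Monotone (fun n => g n x) := by
    intro x m n hmn
    simp only [hgv]
    refine (indicator_le_indicator (SimpleFunc.monotone_eapprox f hmn x)).trans ?_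
    exact indicator_le_indicator_of_subset (Metric.ball_subset_ball (by exact_mod_cast hmn))
      (fun _ => zero_le) x
  have hlim : ∀ x, Tendsto (fun n => g n x) atTop (𝓝 (f x)) := by
    intro x
    refine (SimpleFunc.tendsto_eapprox hf x).congr' ?_
    obtain ⟨N, hN⟩ := exists_nat_gt ‖x‖
    filter_upwards [eventually_ge_atTop N] with n hn
    rw [hgv, indicator_of_mem]
    simpa using hN.trans_le (by exact_mod_cast hn)
  have hfin : ∀ n, ∀ c ≠ 0, volume (g n ⁻¹' {c}) < ∞ := by
    intro n c hc
    refine lt_of_le_of_lt (measure_mono (t := Metric.ball 0 n) ?_) measure_ball_lt_top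
    intro x hx
    by_contra hxb
    rw [mem_preimage, mem_singleton_iff, hgv, indicator_of_notMem hxb] at hx
    exact hc hx.symm
  have hl : Tendsto (fun n => ∫ ω, expNeg (∑' i, g n (X i ω)) ∂μ) atTop
      (𝓝 (∫ ω, expNeg (∑' i, f (X i ω)) ∂μ)) := by
    refine tendsto_integral_of_mem_Icc (fun n => measurable_expNeg.comp ?_)
      (fun n ω => expNeg_nonneg _) (fun n ω => expNeg_le_one _) (ae_of_all _ fun ω => ?_)
    · exact Measurable.tsum fun i => (g n).measurable.comp (hX.measurable_point i)
    · refine (continuous_expNeg.tendsto _).comp ?_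
      simp_rw [← lintegral_count]
      exact lintegral_tendsto_of_tendsto_of_monotone (fun n => (measurable_of_countable _).aemeasurable)
        (ae_of_all _ fun i => hmono _) (ae_of_all _ fun i => hlim _)
  have hr : Tendsto (fun n => expNeg (lam * ∫⁻ x, ENNReal.ofReal (1 - expNeg (g n x)))) atTop
      (𝓝 (expNeg (lam * ∫⁻ x, ENNReal.ofReal (1 - expNeg (f x))))) := by
    refine (continuous_expNeg.tendsto _).comp (ENNReal.Tendsto.const_mul ?_ (by simp))
    refine lintegral_tendsto_of_tendsto_of_monotone (fun n => ?_) (ae_of_all _ fun x => ?_)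
      (ae_of_all _ fun x => ?_)
    · exact (measurable_const.sub
        (measurable_expNeg.comp (g n).measurable)).ennreal_ofReal.aemeasurable
    · exact fun m n hmn => ENNReal.ofReal_le_ofReal
        (sub_le_sub_left (expNeg_antitone (hmono x hmn)) 1)
    · exact (ENNReal.continuous_ofReal.tendsto _).comp
        (((continuous_expNeg.tendsto _).comp (hlim x)).const_sub 1)
  refine tendsto_nhds_unique hl (hr.congr fun n => ?_)
  exact (hX.laplace_simpleFunc (g n) (hfin n)).symm

/-- The probability generating functional of a homogeneous Poisson point process, for functions
`v = 1 - u` with `0 < v ≤ 1` and `u` integrable. -/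
theorem IsHomogeneousPPP.tendsto_integral_prod [IsProbabilityMeasure μ]
    (hX : IsHomogeneousPPP μ lam X) {u : Plane → ℝ} (hu : Integrable u) (hm : Measurable u)
    (h0 : ∀ x, 0 ≤ u x) (h1 : ∀ x, u x < 1) :
    Tendsto (fun n => ∫ ω, ∏ i ∈ Finset.range n, (1 - u (X i ω)) ∂μ) atTop
      (𝓝 (Real.exp (-(lam * ∫ x, u x)))) := by
  -- This choice makes `expNeg (f x) = 1 - u x`; the strict bound `u x < 1` makes the logarithm
  -- meaningful.
  set f : Plane → ℝ≥0∞ := fun x => ENNReal.ofReal (-Real.log (1 - u x)) with hf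
  have hfm : Measurable f := (Real.measurable_log.comp (measurable_const.sub hm)).neg.ennreal_ofReal
  have hfu : ∀ x, expNeg (f x) = 1 - u x := by
    intro x
    have hpos : 0 < 1 - u x := sub_pos.2 (h1 x)
    rw [hf, expNeg_ofReal, neg_neg, Real.exp_log hpos]
    exact neg_nonneg.2 (Real.log_nonpos hpos.le (by linarith [h0 x]))
  have key := hX.laplace hfm
  simp_rw [hfu, sub_sub_cancel] at key
  rw [← ofReal_integral_eq_lintegral_ofReal hu (ae_of_all _ h0),
    expNeg_of_ne_top (ENNReal.mul_ne_top (by simp) (by simp)), ENNReal.toReal_mul,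
    ENNReal.toReal_ofReal (integral_nonneg h0), ENNReal.coe_toReal] at key
  rw [← key]
  refine tendsto_integral_of_mem_Icc (fun n => Finset.measurable_prod _ fun i _ =>
    measurable_const.sub (hm.comp (hX.measurable_point i))) (fun n ω => ?_) (fun n ω => ?_)
    (ae_of_all _ fun ω => ?_)
  · exact Finset.prod_nonneg fun i _ => (sub_pos.2 (h1 _)).le
  · exact Finset.prod_le_one (fun i _ => (sub_pos.2 (h1 _)).le) (fun i _ => by linarith [h0 (X i ω)])
  · simp_rw [← hfu, ← expNeg_sum]
    exact (continuous_expNeg.tendsto _).comp (ENNReal.summable.hasSum.tendsto_sum_nat)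

end LaplaceFunctional

/-! ### Integrating out independent marks and conditionally independent indicators -/

section Marks

variable {Ω : Type*} [mΩ : MeasurableSpace Ω] {μ : Measure Ω} [IsProbabilityMeasure μ]

/-- Integrating out i.i.d. marks `M i` that are independent of `Y`. -/
lemma integral_prod_iid_marks {S E : Type*} [MeasurableSpace S] [MeasurableSpace E]
    {M : ℕ → Ω → S} (hMm : ∀ i, Measurable (M i)) (hM : iIndepFun M μ)
    (hid : ∀ i, IdentDistrib (M i) (M 0) μ μ) {Y : Ω → E} (hY : Measurable Y)
    (hind : IndepFun (fun ω (i : ℕ) => M i ω) Y μ) {g : ℕ → S → E → ℝ}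
    (hg : ∀ i, Measurable (Function.uncurry (g i)))
    (h0 : ∀ i m y, 0 ≤ g i m y) (h1 : ∀ i m y, g i m y ≤ 1) (n : ℕ) :
    ∫ ω, ∏ i ∈ Finset.range n, g i (M i ω) (Y ω) ∂μ =
      ∫ ω, ∏ i ∈ Finset.range n, (∫ ω', g i (M 0 ω') (Y ω) ∂μ) ∂μ := by
  have hMM : Measurable (fun ω (i : ℕ) => M i ω) := measurable_pi_lambda _ hMm
  have hprod := (indepFun_iff_map_prod_eq_prod_map_map hMM.aemeasurable hY.aemeasurable).1 hind
  have : IsProbabilityMeasure (μ.map (fun ω (i : ℕ) => M i ω)) :=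
    Measure.isProbabilityMeasure_map hMM.aemeasurable
  have : IsProbabilityMeasure (μ.map Y) := Measure.isProbabilityMeasure_map hY.aemeasurable
  have hgi : ∀ i, Measurable (fun p : (ℕ → S) × E => g i (p.1 i) p.2) := fun i =>
    (hg i).comp (f := fun p : (ℕ → S) × E => (p.1 i, p.2))
      (((measurable_pi_apply i).comp measurable_fst).prodMk measurable_snd)
  set F : (ℕ → S) × E → ℝ := fun p => ∏ i ∈ Finset.range n, g i (p.1 i) p.2 with hF
  have hFm : Measurable F := Finset.measurable_prod _ fun i _ => hgi i
  have hFi : Integrable F ((μ.map (fun ω (i : ℕ) => M i ω)).prod (μ.map Y)) :=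
    integrable_of_mem_Icc hFm (fun p => Finset.prod_nonneg fun i _ => h0 _ _ _)
      (fun p => Finset.prod_le_one (fun i _ => h0 _ _ _) (fun i _ => h1 _ _ _))
  -- Once `y` is frozen, the factors are functions of distinct independent marks, each distributed
  -- as `M 0`.
  have hinner : ∀ y, ∫ m, F (m, y) ∂(μ.map (fun ω (i : ℕ) => M i ω)) =
      ∏ i ∈ Finset.range n, ∫ ω', g i (M 0 ω') y ∂μ := by
    intro y
    have hgy : ∀ i, Measurable (fun m => g i m y) := fun i =>
      (hg i).comp (measurable_id.prodMk measurable_const)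
    rw [integral_map (f := fun m => F (m, y)) hMM.aemeasurable
      (hFm.comp (measurable_id.prodMk measurable_const)).aestronglyMeasurable]
    simp only [hF]
    have hfin : iIndepFun (fun i : Finset.range n => M i) μ := hM.precomp Subtype.val_injective
    have h2 := hfin.integral_fun_prod_comp (f := fun (i : Finset.range n) m => g i m y)
      (fun i => (hMm _).aemeasurable) (fun i => (hgy _).aestronglyMeasurable)
    rw [Finset.prod_coe_sort (Finset.range n) (fun i => ∫ ω, g i (M i ω) y ∂μ)] at h2
    calc _ = _ := by
          refine Eq.trans ?_ h2
          congr 1; ext ω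
          exact (Finset.prod_coe_sort (Finset.range n) (fun i => g i (M i ω) y)).symm
      _ = _ := Finset.prod_congr rfl fun i _ => ((hid i).comp (hgy i)).integral_eq
  have hmeas2 : Measurable (fun y => ∏ i ∈ Finset.range n, ∫ ω', g i (M 0 ω') y ∂μ) := by
    refine Finset.measurable_prod _ fun i _ => ?_
    have : StronglyMeasurable (fun p : E × Ω => g i (M 0 p.2) p.1) :=
      ((hg i).comp (((hMm 0).comp measurable_snd).prodMk measurable_fst)).stronglyMeasurable
    exact this.integral_prod_right'.measurable
  calc ∫ ω, ∏ i ∈ Finset.range n, g i (M i ω) (Y ω) ∂μ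
      = ∫ p, F p ∂(μ.map (fun ω => ((fun i : ℕ => M i ω), Y ω))) :=
        (integral_map (hMM.prodMk hY).aemeasurable hFm.aestronglyMeasurable).symm
    _ = ∫ y, ∫ m, F (m, y) ∂(μ.map (fun ω (i : ℕ) => M i ω)) ∂(μ.map Y) := by
        rw [hprod, integral_prod_symm _ hFi]
    _ = ∫ y, ∏ i ∈ Finset.range n, (∫ ω', g i (M 0 ω') y ∂μ) ∂(μ.map Y) := by
        simp_rw [hinner]
    _ = _ := integral_map hY.aemeasurable hmeas2.aestronglyMeasurable

/-- Integrating out indicators `los i` that are conditionally independent given `m`, with success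
probabilities `p i`. -/
lemma integral_prod_cond_indep_bool {Ω : Type*} (m : MeasurableSpace Ω) [mΩ : MeasurableSpace Ω]
    {μ : Measure Ω} [IsProbabilityMeasure μ] (hm : m ≤ mΩ) {los : ℕ → Ω → Bool}
    (hlos : ∀ i, Measurable (los i)) {p : ℕ → Ω → ℝ} (hpm : ∀ i, Measurable (p i))
    (hp0 : ∀ i ω, 0 ≤ p i ω) (hp1 : ∀ i ω, p i ω ≤ 1)
    (hcond : ∀ F : Finset ℕ, μ⟦⋂ i ∈ F, {ω | los i ω = true} | m⟧
      =ᵐ[μ] fun ω => ∏ i ∈ F, p i ω)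
    {a b : ℕ → Ω → ℝ} (ha : ∀ i, Measurable[m] (a i)) (hb : ∀ i, Measurable[m] (b i))
    (ha0 : ∀ i ω, 0 ≤ a i ω) (ha1 : ∀ i ω, a i ω ≤ 1)
    (hb0 : ∀ i ω, 0 ≤ b i ω) (hb1 : ∀ i ω, b i ω ≤ 1) (n : ℕ) :
    ∫ ω, ∏ i ∈ Finset.range n, (if los i ω then a i ω else b i ω) ∂μ =
      ∫ ω, ∏ i ∈ Finset.range n, (p i ω * a i ω + (1 - p i ω) * b i ω) ∂μ := by
  classical
  -- The hypothesis only gives conditional probabilities that all links in a finite set are LoS.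
  -- Each factor is therefore written as `1_los (a - b) + b` and the product expanded over subsets
  -- `t`: the indicators then occur only through the event that all of `t` is LoS, with an
  -- `m`-measurable coefficient `h t`.
  set h : Finset ℕ → Ω → ℝ := fun t ω =>
    (∏ i ∈ t, (a i ω - b i ω)) * ∏ i ∈ Finset.range n \ t, b i ω with hh
  have hhm : ∀ t, Measurable[m] (h t) := fun t =>
    (Finset.measurable_prod _ fun i _ => (ha i).sub (hb i)).mul
      (Finset.measurable_prod _ fun i _ => hb i)
  have hhb : ∀ t ω, |h t ω| ≤ 1 := by
    intro t ω
    rw [hh, abs_mul, Finset.abs_prod, Finset.abs_prod]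
    refine mul_le_one₀ (Finset.prod_le_one (fun i _ => abs_nonneg _) fun i _ => ?_)
      (Finset.prod_nonneg fun i _ => abs_nonneg _)
      (Finset.prod_le_one (fun i _ => abs_nonneg _) fun i _ => ?_)
    · rw [abs_le]
      constructor <;> linarith [ha0 i ω, ha1 i ω, hb0 i ω, hb1 i ω]
    · rw [abs_of_nonneg (hb0 i ω)]; exact hb1 i ω
  have hsm : ∀ t : Finset ℕ, MeasurableSet (⋂ i ∈ t, {ω | los i ω = true}) := fun t =>
    Finset.measurableSet_biInter _ fun i _ => hlos i (measurableSet_singleton true)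
  set q : Finset ℕ → Ω → ℝ := fun t => (⋂ i ∈ t, {ω | los i ω = true}).indicator fun _ => (1 : ℝ)
    with hq
  have hqm : ∀ t, Measurable (q t) := fun t => measurable_const.indicator (hsm t)
  have hq01 : ∀ t ω, |q t ω| ≤ 1 := by
    intro t ω
    simp only [hq, indicator_apply]
    split_ifs <;> simp
  have hbdd : ∀ {f : Ω → ℝ}, Measurable f → (∀ ω, |f ω| ≤ 1) → ∀ t,
      Integrable (fun ω => f ω * h t ω) μ := by
    intro f hf hf1 t
    refine Integrable.of_bound (hf.mul ((hhm t).mono hm le_rfl)).aestronglyMeasurable 1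
      (ae_of_all _ fun ω => ?_)
    rw [Real.norm_eq_abs, abs_mul]
    exact mul_le_one₀ (hf1 ω) (abs_nonneg _) (hhb t ω)
  have hP : ∀ t : Finset ℕ, ∀ ω, |∏ i ∈ t, p i ω| ≤ 1 := fun t ω => by
    rw [abs_of_nonneg (Finset.prod_nonneg fun i _ => hp0 i ω)]
    exact Finset.prod_le_one (fun i _ => hp0 i ω) (fun i _ => hp1 i ω)
  have hPm : ∀ t : Finset ℕ, Measurable (fun ω => ∏ i ∈ t, p i ω) := fun t =>
    Finset.measurable_prod _ fun i _ => hpm i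
  have hl : ∀ ω, ∏ i ∈ Finset.range n, (if los i ω then a i ω else b i ω) =
      ∑ t ∈ (Finset.range n).powerset, q t ω * h t ω := by
    intro ω
    have : ∀ i ∈ Finset.range n, (if los i ω then a i ω else b i ω) =
        (if los i ω then 1 else 0) * (a i ω - b i ω) + b i ω := by
      intro i _; split_ifs <;> ring
    rw [Finset.prod_congr rfl this, Finset.prod_add]
    refine Finset.sum_congr rfl fun t _ => ?_
    rw [Finset.prod_mul_distrib, hh, mul_assoc]
    congr 1
    by_cases hall : ∀ i ∈ t, los i ω = true
    · rw [Finset.prod_congr rfl (fun i hi => by rw [if_pos (hall i hi)]), Finset.prod_const_one, hq]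
      have hmem : ω ∈ ⋂ i ∈ t, {ω | los i ω = true} := by simpa using hall
      exact (indicator_of_mem hmem (fun _ => (1 : ℝ))).symm
    · have hall' := hall
      push Not at hall
      obtain ⟨i, hi, hne⟩ := hall
      rw [Finset.prod_eq_zero hi (by rw [if_neg hne]), hq]
      have hmem : ω ∉ ⋂ i ∈ t, {ω | los i ω = true} := by simpa using hall'
      exact (indicator_of_notMem hmem (fun _ => (1 : ℝ))).symm
  have hr : ∀ ω, ∏ i ∈ Finset.range n, (p i ω * a i ω + (1 - p i ω) * b i ω) =
      ∑ t ∈ (Finset.range n).powerset, (∏ i ∈ t, p i ω) * h t ω := by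
    intro ω
    have : ∀ i ∈ Finset.range n, p i ω * a i ω + (1 - p i ω) * b i ω =
        p i ω * (a i ω - b i ω) + b i ω := by
      intro i _; ring
    rw [Finset.prod_congr rfl this, Finset.prod_add]
    refine Finset.sum_congr rfl fun t _ => ?_
    rw [Finset.prod_mul_distrib, hh, mul_assoc]
  simp_rw [hl, hr]
  rw [integral_finsetSum _ fun t _ => hbdd (hqm t) (hq01 t) t,
    integral_finsetSum _ fun t _ => hbdd (hPm t) (hP t) t]
  refine Finset.sum_congr rfl fun t _ => ?_
  have hqi : Integrable (q t) μ := (integrable_const (1 : ℝ)).indicator (hsm t)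
  -- Tower property: condition on `m`, pull out `h t`, and insert the given conditional probability.
  rw [← integral_condExp hm]
  refine integral_congr_ae ?_
  refine (condExp_mul_of_stronglyMeasurable_right (f := q t) (hhm t).stronglyMeasurable
    (hbdd (hqm t) (hq01 t) t) hqi).trans ?_
  filter_upwards [hcond t] with ω hω
  rw [Pi.mul_apply, ← hω]

end Marks

/-! ### Radial integration with respect to the squared norm -/

section Radial

/-- The disc of radius `√t` has area `π t`, so both measures agree on every `Iic t`, with finite
values, and hence on half-open intervals. -/
lemma map_norm_sq_volume :
    (volume : Measure Plane).map (fun x => ‖x‖ ^ 2) =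
      ENNReal.ofReal Real.pi • (volume : Measure ℝ).restrict (Ioi 0) := by
  have hm : Measurable (fun x : Plane => ‖x‖ ^ 2) := by fun_prop
  set ν := (volume : Measure Plane).map (fun x => ‖x‖ ^ 2) with hν
  set κ := ENNReal.ofReal Real.pi • (volume : Measure ℝ).restrict (Ioi 0) with hκ
  have h1 : ∀ t, ν (Iic t) = ENNReal.ofReal t * ENNReal.ofReal Real.pi := by
    intro t
    rw [hν, Measure.map_apply hm measurableSet_Iic]
    rcases lt_or_ge t 0 with ht | ht
    · have : (fun x : Plane => ‖x‖ ^ 2) ⁻¹' Iic t = ∅ := by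
        ext x
        simp only [mem_preimage, mem_Iic, mem_empty_iff_false, iff_false, not_le]
        exact ht.trans_le (by positivity)
      rw [this, ENNReal.ofReal_of_nonpos ht.le]; simp
    · have : (fun x : Plane => ‖x‖ ^ 2) ⁻¹' Iic t = Metric.closedBall 0 (Real.sqrt t) := by
        ext x
        simp only [mem_preimage, mem_Iic, mem_closedBall_zero_iff]
        exact (Real.le_sqrt (norm_nonneg _) ht).symm
      rw [this, EuclideanSpace.volume_closedBall_fin_two, ← ENNReal.ofReal_pow (Real.sqrt_nonneg _),
        Real.sq_sqrt ht]
  have h2 : ∀ t, κ (Iic t) = ENNReal.ofReal t * ENNReal.ofReal Real.pi := by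
    intro t
    rw [hκ, Measure.smul_apply, Measure.restrict_apply measurableSet_Iic, Iic_inter_Ioi,
      Real.volume_Ioc, sub_zero, smul_eq_mul, mul_comm]
  have hfin : ∀ t : ℝ, ENNReal.ofReal t * ENNReal.ofReal Real.pi ≠ ∞ := fun t =>
    ENNReal.mul_ne_top ENNReal.ofReal_ne_top ENNReal.ofReal_ne_top
  have hIoc : ∀ (Q : Measure ℝ), (∀ t, Q (Iic t) = ENNReal.ofReal t * ENNReal.ofReal Real.pi) →
      ∀ a b, a < b → Q (Ioc a b) = ENNReal.ofReal b * ENNReal.ofReal Real.pi -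
        ENNReal.ofReal a * ENNReal.ofReal Real.pi := by
    intro Q hQ a b hab
    rw [← Iic_sdiff_Iic, measure_sdiff (Iic_subset_Iic.2 hab.le) measurableSet_Iic.nullMeasurableSet
      (by rw [hQ]; exact hfin a), hQ, hQ]
  refine Measure.ext_of_Ioc' _ _ (fun a b hab => ?_) (fun a b hab => ?_)
  · rw [hIoc ν h1 a b hab]
    exact (tsub_le_self.trans_lt (lt_top_iff_ne_top.2 (hfin b))).ne
  · rw [hIoc ν h1 a b hab, hIoc κ h2 a b hab]

lemma measurable_norm_sq_plane : Measurable (fun x : Plane => ‖x‖ ^ 2) := by fun_prop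

lemma lintegral_norm_sq {f : ℝ → ℝ≥0∞} (hf : Measurable f) :
    ∫⁻ x : Plane, f (‖x‖ ^ 2) = ENNReal.ofReal Real.pi * ∫⁻ z in Ioi (0 : ℝ), f z := by
  rw [← lintegral_map hf measurable_norm_sq_plane, map_norm_sq_volume, lintegral_smul_measure,
    smul_eq_mul]

lemma integral_norm_sq {f : ℝ → ℝ} (hf : Measurable f) :
    ∫ x : Plane, f (‖x‖ ^ 2) = Real.pi * ∫ z in Ioi (0 : ℝ), f z := by
  rw [← integral_map measurable_norm_sq_plane.aemeasurable hf.aestronglyMeasurable,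
    map_norm_sq_volume, integral_smul_measure, ENNReal.toReal_ofReal Real.pi_pos.le, smul_eq_mul]

lemma integrable_norm_sq_iff {f : ℝ → ℝ} (hf : Measurable f) :
    Integrable (fun x : Plane => f (‖x‖ ^ 2)) ↔ IntegrableOn f (Ioi 0) := by
  have h := integrable_map_measure (μ := (volume : Measure Plane)) hf.aestronglyMeasurable
    measurable_norm_sq_plane.aemeasurable
  rw [map_norm_sq_volume, integrable_smul_measure (by simp [Real.pi_pos]) (by simp)] at h
  exact h.symm

end Radial

/-! ### Laplace transforms and the Gamma integral -/

lemma intervalIntegral_exp_neg (c : ℝ) : ∫ t in (0 : ℝ)..c, Real.exp (-t) = 1 - Real.exp (-c) := by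
  rw [intervalIntegral.integral_comp_neg (fun t => Real.exp t), integral_exp]
  simp

/-- Layer-cake formula for `1 - exp (-y) = ∫₀^y exp (-t) dt` with `y = a z ^ (-β)`. The set of `z >
0` with `y ≥ t` is `(0, (a / t) ^ (1 / β)]`, so what remains is `a ^ (1 / β) ∫ t ^ (-1 / β) exp (-t)
dt`, a Gamma integral that converges at `0` because `β > 1`. -/
lemma lintegral_one_sub_exp_neg_rpow {a β : ℝ} (ha : 0 ≤ a) (hβ : 1 < β) :
    ∫⁻ z in Ioi (0 : ℝ), ENNReal.ofReal (1 - Real.exp (-(a * z ^ (-β)))) =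
      ENNReal.ofReal (a ^ (1 / β) * Real.Gamma (1 - 1 / β)) := by
  have hβ0 : 0 < β := by linarith
  have hβ1 : 0 < 1 - 1 / β := by
    rw [sub_pos, div_lt_one hβ0]; exact hβ
  rcases ha.eq_or_lt with rfl | ha
  · simp [Real.zero_rpow (inv_ne_zero hβ0.ne')]
  have hnn : 0 ≤ᵐ[volume.restrict (Ioi (0 : ℝ))] fun z => a * z ^ (-β) := by
    filter_upwards [ae_restrict_mem measurableSet_Ioi] with z hz
    have hz' : (0 : ℝ) < z := hz
    change 0 ≤ a * z ^ (-β)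
    positivity
  have hm : Measurable (fun z : ℝ => a * z ^ (-β)) := by fun_prop
  have key := lintegral_comp_eq_lintegral_meas_le_mul (volume.restrict (Ioi (0 : ℝ))) hnn
    hm.aemeasurable (g := fun t => Real.exp (-t))
    (fun t _ => (by fun_prop : Continuous fun t : ℝ => Real.exp (-t)).intervalIntegrable _ _)
    (ae_of_all _ fun t => (Real.exp_pos _).le)
  simp_rw [intervalIntegral_exp_neg] at key
  have hset : ∀ t ∈ Ioi (0 : ℝ), (volume.restrict (Ioi (0 : ℝ))) {z : ℝ | t ≤ a * z ^ (-β)} *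
      ENNReal.ofReal (Real.exp (-t)) =
      ENNReal.ofReal (a ^ (1 / β) * (Real.exp (-t) * t ^ ((1 - 1 / β) - 1))) := by
    intro t ht
    have ht : 0 < t := ht
    have hs : {z : ℝ | t ≤ a * z ^ (-β)} ∩ Ioi 0 = Ioc 0 ((a / t) ^ (1 / β)) := by
      ext z
      simp only [mem_inter_iff, mem_ofPred_eq, mem_Ioi, mem_Ioc]
      rw [and_comm]
      refine and_congr_right fun hz => ?_
      rw [Real.rpow_neg hz.le, ← div_eq_mul_inv, le_div_comm₀ ht (by positivity), one_div,
        Real.le_rpow_inv_iff_of_pos hz.le (by positivity) hβ0]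
    rw [Measure.restrict_apply (measurableSet_le measurable_const hm), hs, Real.volume_Ioc, sub_zero,
      ← ENNReal.ofReal_mul (by positivity), Real.div_rpow ha.le ht.le]
    congr 1
    rw [show (1 - 1 / β) - 1 = -(1 / β) by ring, Real.rpow_neg ht.le]
    ring
  rw [key, setLIntegral_congr_fun measurableSet_Ioi hset, Real.Gamma_eq_integral hβ1,
    ← integral_const_mul, ofReal_integral_eq_lintegral_ofReal]
  · exact (Real.GammaIntegral_convergent hβ1).const_mul _
  · filter_upwards [ae_restrict_mem measurableSet_Ioi] with t ht
    have ht : 0 < t := ht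
    change 0 ≤ a ^ (1 / β) * (Real.exp (-t) * t ^ ((1 - 1 / β) - 1))
    positivity

section Laplace

variable {Ω : Type*} [mΩ : MeasurableSpace Ω] {μ : Measure Ω} [IsProbabilityMeasure μ]

section

variable {Z : Ω → ℝ} (hZ : Measurable Z) (hZ0 : ∀ ω, 0 ≤ Z ω)
include hZ hZ0

lemma integrable_exp_neg_mul {t : ℝ} (ht : 0 ≤ t) :
    Integrable (fun ω => Real.exp (-t * Z ω)) μ :=
  integrable_of_mem_Icc (by fun_prop) (fun ω => (Real.exp_pos _).le)
    (fun ω => Real.exp_le_one_iff.2 (by nlinarith [hZ0 ω, mul_nonneg ht (hZ0 ω)]))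

lemma laplaceTransform_le_one {t : ℝ} (ht : 0 ≤ t) : laplaceTransform μ Z t ≤ 1 := by
  have : ∫ ω, Real.exp (-t * Z ω) ∂μ ≤ ∫ _, (1 : ℝ) ∂μ :=
    integral_mono (integrable_exp_neg_mul hZ hZ0 ht) (integrable_const _)
      (fun ω => Real.exp_le_one_iff.2 (by nlinarith [hZ0 ω, mul_nonneg ht (hZ0 ω)]))
  simpa [laplaceTransform] using this

lemma laplaceTransform_anti {t u : ℝ} (ht : 0 ≤ t) (htu : t ≤ u) :
    laplaceTransform μ Z u ≤ laplaceTransform μ Z t :=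
  integral_mono (integrable_exp_neg_mul hZ hZ0 (ht.trans htu)) (integrable_exp_neg_mul hZ hZ0 ht)
    (fun ω => Real.exp_le_exp.2 (by nlinarith [hZ0 ω, mul_le_mul_of_nonneg_right htu (hZ0 ω)]))

lemma laplaceTransform_pos {t : ℝ} (ht : 0 ≤ t) : 0 < laplaceTransform μ Z t :=
  integral_exp_pos (integrable_exp_neg_mul hZ hZ0 ht)

omit hZ0 in
lemma measurable_laplaceTransform : Measurable (laplaceTransform μ Z) := by
  have : StronglyMeasurable (fun p : ℝ × Ω => Real.exp (-p.1 * Z p.2)) := by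
    refine Measurable.stronglyMeasurable ?_
    fun_prop
  exact this.integral_prod_right'.measurable

/-- The integral of `1 - L_Z (a ‖x‖ ^ (-α))` over the plane. -/
lemma lintegral_one_sub_laplaceTransform {α : ℝ} (hα : 2 < α)
    (hZi : Integrable (fun ω => Z ω ^ (2 / α)) μ) {a : ℝ} (ha : 0 ≤ a) :
    ∫⁻ x : Plane, ENNReal.ofReal (1 - laplaceTransform μ Z (a * ‖x‖ ^ (-α))) =
      ENNReal.ofReal (Real.pi * a ^ (2 / α) * (∫ ω, Z ω ^ (2 / α) ∂μ) *
        Real.Gamma (1 - 2 / α)) := by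
  have hβ : 1 < α / 2 := by linarith
  have hG : 0 < Real.Gamma (1 - 2 / α) := Real.Gamma_pos_of_pos (by
    rw [sub_pos, div_lt_one (by linarith)]; exact hα)
  have hinv : 1 / (α / 2) = 2 / α := by rw [one_div_div]
  have h1 : ∀ x : Plane, ‖x‖ ^ (-α) = (‖x‖ ^ 2) ^ (-(α / 2)) := by
    intro x
    rw [← Real.rpow_natCast, ← Real.rpow_mul (norm_nonneg _)]
    congr 1; push_cast; ring
  simp_rw [h1]
  rw [lintegral_norm_sq (f := fun z => ENNReal.ofReal
    (1 - laplaceTransform μ Z (a * z ^ (-(α / 2)))))]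
  swap
  · exact (measurable_const.sub ((measurable_laplaceTransform hZ).comp (by fun_prop))).ennreal_ofReal
  -- The integrand becomes an expectation over `Z`, so that Tonelli reduces the claim to the Gamma
  -- integral for each fixed value of `Z`, with exponent `β = α / 2`.
  have h2 : ∀ z ∈ Ioi (0 : ℝ), ENNReal.ofReal (1 - laplaceTransform μ Z (a * z ^ (-(α / 2)))) =
      ∫⁻ ω, ENNReal.ofReal (1 - Real.exp (-(a * Z ω * z ^ (-(α / 2))))) ∂μ := by
    intro z hz
    have hz : 0 < z := hz
    have hnn : 0 ≤ a * z ^ (-(α / 2)) := by positivity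
    have hi := integrable_exp_neg_mul (μ := μ) hZ hZ0 hnn
    rw [← ofReal_integral_eq_lintegral_ofReal]
    · have : ∀ ω, Real.exp (-(a * Z ω * z ^ (-(α / 2)))) =
          Real.exp (-(a * z ^ (-(α / 2))) * Z ω) := fun ω => by congr 1; ring
      simp_rw [this]
      rw [integral_sub (integrable_const _) hi]
      simp [laplaceTransform]
    · refine (integrable_const (1 : ℝ)).sub (hi.congr (ae_of_all _ fun ω => ?_))
      simp only; congr 1; ring
    · refine ae_of_all _ fun ω => sub_nonneg.2 (Real.exp_le_one_iff.2 ?_)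
      have := hZ0 ω
      rw [neg_nonpos]; positivity
  rw [setLIntegral_congr_fun measurableSet_Ioi h2, lintegral_lintegral_swap]
  swap
  · refine Measurable.aemeasurable ?_
    fun_prop
  have h3 : ∀ ω, ∫⁻ z in Ioi (0 : ℝ), ENNReal.ofReal (1 - Real.exp (-(a * Z ω * z ^ (-(α / 2))))) =
      ENNReal.ofReal (a ^ (2 / α) * Z ω ^ (2 / α) * Real.Gamma (1 - 2 / α)) := by
    intro ω
    rw [lintegral_one_sub_exp_neg_rpow (mul_nonneg ha (hZ0 ω)) hβ, hinv,
      Real.mul_rpow ha (hZ0 ω)]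
  simp_rw [h3]
  rw [← ofReal_integral_eq_lintegral_ofReal, ← ENNReal.ofReal_mul Real.pi_pos.le,
    integral_mul_const, integral_const_mul]
  · congr 1; ring
  · exact (hZi.const_mul _).mul_const _
  · refine ae_of_all _ fun ω => ?_
    have := hZ0 ω
    change 0 ≤ a ^ (2 / α) * Z ω ^ (2 / α) * Real.Gamma (1 - 2 / α)
    positivity

end

end Laplace

/-! ### Path gain, LoS probability and points at the origin -/

/-- The projection of an angle to `[0, π/2]`. -/
noncomputable def clampAngle (θ : ℝ) : ℝ := max 0 (min θ (Real.pi / 2))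

lemma clampAngle_mem (θ : ℝ) : clampAngle θ ∈ Icc 0 (Real.pi / 2) :=
  ⟨le_max_left _ _, max_le Real.pi_div_two_pos.le (min_le_right _ _)⟩

lemma clampAngle_of_mem {θ : ℝ} (h : θ ∈ Icc 0 (Real.pi / 2)) : clampAngle θ = θ := by
  rw [clampAngle, min_eq_left h.2, max_eq_right h.1]

/-- The angles lie in `[0, π/2]` only almost surely; clamping makes this sign, and the bounds built
on it, valid for every real `θ`. -/
lemma cos_clampAngle_nonneg (θ : ℝ) : 0 ≤ Real.cos (clampAngle θ) :=
  Real.cos_nonneg_of_mem_Icc ⟨by linarith [(clampAngle_mem θ).1, Real.pi_pos], (clampAngle_mem θ).2⟩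

@[fun_prop]
lemma measurable_clampAngle : Measurable clampAngle := by
  unfold clampAngle; fun_prop

/-- The path gain `‖U‖ ^ (-α)` of the point `U` with projection `x` seen at elevation angle `θ`. -/
noncomputable def pathGain (α : ℝ) (x : Plane) (θ : ℝ) : ℝ :=
  ‖x‖ ^ (-α) * Real.cos (clampAngle θ) ^ α

lemma pathGain_nonneg (α : ℝ) (x : Plane) (θ : ℝ) : 0 ≤ pathGain α x θ :=
  mul_nonneg (by positivity) (Real.rpow_nonneg (cos_clampAngle_nonneg θ) _)

lemma pathGain_le {α : ℝ} (hα : 0 ≤ α) (x : Plane) (θ : ℝ) : pathGain α x θ ≤ ‖x‖ ^ (-α) :=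
  mul_le_of_le_one_right (by positivity)
    (Real.rpow_le_one (cos_clampAngle_nonneg θ) (Real.cos_le_one _) hα)

lemma Measurable.pathGain {E : Type*} {_ : MeasurableSpace E} {f : E → Plane} {g : E → ℝ} (α : ℝ)
    (hf : Measurable f) (hg : Measurable g) : Measurable (fun y => pathGain α (f y) (g y)) := by
  unfold _root_.pathGain; fun_prop

/-- For `θ < π/2` this is `1 + tan² = 1 / cos²`. At `θ = π/2` the altitude is `∞` and both sides
vanish; this needs `x ≠ 0`, since `0 * ∞ = 0` would put the point at the origin. -/
lemma spaceNorm_rpow_neg {α : ℝ} (hα : 0 < α) {x : Plane} (hx : x ≠ 0) {θ : ℝ}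
    (hθ : θ ∈ Icc 0 (Real.pi / 2)) :
    spaceNorm x (ENNReal.ofReal ‖x‖ * extTan θ) ^ (-α) = ENNReal.ofReal (pathGain α x θ) := by
  have hx0 : 0 < ‖x‖ := norm_pos_iff.2 hx
  rw [pathGain, clampAngle_of_mem hθ]
  rcases eq_or_lt_of_le hθ.2 with h | h
  · rw [h, extTan, Real.sin_pi_div_two, Real.cos_pi_div_two]
    have h1 : ENNReal.ofReal ‖x‖ * (ENNReal.ofReal 1 / ENNReal.ofReal 0) = ∞ := by
      rw [ENNReal.ofReal_zero, ENNReal.ofReal_one, ENNReal.div_zero one_ne_zero,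
        ENNReal.mul_top (ENNReal.ofReal_pos.2 hx0).ne']
    rw [h1]
    simp [spaceNorm, hα, hα.ne']
  · have hc : 0 < Real.cos θ := Real.cos_pos_of_mem_Ioo ⟨by linarith [hθ.1, Real.pi_pos], h⟩
    have hs : 0 ≤ Real.sin θ := Real.sin_nonneg_of_nonneg_of_le_pi hθ.1 (by linarith [Real.pi_pos])
    have hn : spaceNorm x (ENNReal.ofReal ‖x‖ * extTan θ) = ENNReal.ofReal (‖x‖ / Real.cos θ) := by
      rw [spaceNorm, extTan, ← ENNReal.ofReal_div_of_pos hc, ← ENNReal.ofReal_mul hx0.le,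
        ← ENNReal.ofReal_pow hx0.le, ← ENNReal.ofReal_pow (by positivity),
        ← ENNReal.ofReal_add (by positivity) (by positivity),
        ENNReal.ofReal_rpow_of_nonneg (by positivity) (by norm_num), ← Real.sqrt_eq_rpow]
      congr 1
      rw [Real.sqrt_eq_iff_mul_self_eq (by positivity) (by positivity)]
      field_simp
      nlinarith [Real.sin_sq_add_cos_sq θ]
    rw [hn, ENNReal.ofReal_rpow_of_pos (by positivity), Real.div_rpow hx0.le hc.le,
      Real.rpow_neg hc.le, div_inv_eq_mul]

lemma losProb_pos {c₁ c₂ : ℝ} (hc₂ : 0 < c₂) (θ : ℝ) : 0 < losProb c₁ c₂ θ := by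
  unfold losProb; positivity

lemma losProb_le_one {c₁ c₂ : ℝ} (hc₂ : 0 < c₂) (θ : ℝ) : losProb c₁ c₂ θ ≤ 1 := by
  unfold losProb
  rw [div_le_one (by positivity)]
  linarith [mul_pos hc₂ (Real.exp_pos (-c₁ * θ))]

@[fun_prop]
lemma measurable_losProb (c₁ c₂ : ℝ) : Measurable (losProb c₁ c₂) := by
  unfold losProb; fun_prop

lemma channelGain_nonneg {ℓ : ℝ} (hℓ : 0 ≤ ℓ) (b : Bool) : 0 ≤ channelGain ℓ b := by
  unfold channelGain; split_ifs <;> simp [hℓ]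

/-- The origin has area zero, so the number of points there is Poisson with mean `0`. -/
lemma IsHomogeneousPPP.ae_ne_zero {Ω : Type*} [MeasurableSpace Ω] {μ : Measure Ω}
    [IsProbabilityMeasure μ] {lam : ℝ≥0} {X : ℕ → Ω → Plane} (hX : IsHomogeneousPPP μ lam X) :
    ∀ᵐ ω ∂μ, ∀ i, X i ω ≠ 0 := by
  have h := hX.poisson_count {0} (measurableSet_singleton 0) (by simp) 0
  have h1 : μ {ω | pointCount X {0} ω = 0} = 1 := by
    simpa [poissonMeasure_singleton] using h
  have hm : MeasurableSet {ω | pointCount X {0} ω = 0} :=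
    hX.measurable_pointCount (measurableSet_singleton _) (measurableSet_singleton 0)
  have h2 : ∀ᵐ ω ∂μ, pointCount X {0} ω = 0 := (prob_compl_eq_zero_iff hm).2 h1
  filter_upwards [h2] with ω hω i hi
  rw [pointCount, encard_eq_zero] at hω
  have : i ∈ ({i : ℕ | X i ω ∈ ({0} : Set Plane)}) := hi
  rw [hω] at this
  exact this

/-! ### The loss of a single link -/

section Shot

variable {Ω : Type*} [mΩ : MeasurableSpace Ω] (μ : Measure Ω) (α ℓ c₁ c₂ : ℝ) (W : Ω → ℝ≥0)

/-- One minus the expectation of `exp (-s W L ‖U‖ ^ (-α))` over the weight and the channel factor,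
for the point `U` with projection `x` seen at elevation angle `θ`. -/
noncomputable def linkLoss (s : ℝ) (x : Plane) (θ : ℝ) : ℝ :=
  losProb c₁ c₂ θ * (1 - laplaceTransform μ (fun ω => (W ω : ℝ)) (s * pathGain α x θ)) +
    (1 - losProb c₁ c₂ θ) *
      (1 - laplaceTransform μ (fun ω => (W ω : ℝ)) (s * ℓ * pathGain α x θ))

variable {α ℓ c₁ c₂ W} [IsProbabilityMeasure μ]

lemma Measurable.linkLoss {E : Type*} {_ : MeasurableSpace E} {f : E → Plane} {g : E → ℝ}
    (hW : Measurable W) (s : ℝ) (hf : Measurable f) (hg : Measurable g) :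
    Measurable (fun y => linkLoss μ α ℓ c₁ c₂ W s (f y) (g y)) := by
  have hL := measurable_laplaceTransform (μ := μ) (Z := fun ω => (W ω : ℝ)) hW.coe_nnreal_real
  have hk := hf.pathGain α hg
  have hp : Measurable (fun y => losProb c₁ c₂ (g y)) := by fun_prop
  have h1 := hL.comp (hk.const_mul s)
  have h2 := hL.comp (hk.const_mul (s * ℓ))
  exact (hp.mul (measurable_const.sub h1)).add
    ((measurable_const.sub hp).mul (measurable_const.sub h2))

lemma linkLoss_nonneg (hW : Measurable W) (hℓ : ℓ ∈ Icc (0 : ℝ) 1) (hc₂ : 0 < c₂) {s : ℝ}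
    (hs : 0 ≤ s) (x : Plane) (θ : ℝ) : 0 ≤ linkLoss μ α ℓ c₁ c₂ W s x θ := by
  have hg := pathGain_nonneg α x θ
  have h : ∀ t, 0 ≤ t → 0 ≤ 1 - laplaceTransform μ (fun ω => (W ω : ℝ)) t := fun t ht =>
    sub_nonneg.2 (laplaceTransform_le_one hW.coe_nnreal_real (fun _ => NNReal.coe_nonneg _) ht)
  exact add_nonneg (mul_nonneg (losProb_pos hc₂ θ).le (h _ (by positivity)))
    (mul_nonneg (sub_nonneg.2 (losProb_le_one hc₂ θ))
      (h _ (mul_nonneg (mul_nonneg hs hℓ.1) hg)))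

/-- Both terms are largest for a LoS link at elevation zero, because the path gain is at most `‖x‖ ^
(-α)` and `ℓ ≤ 1`. The bound does not involve `θ`, so it dominates the loss however angles depend on
projections. -/
lemma linkLoss_le (hW : Measurable W) (hα : 0 ≤ α) (hℓ : ℓ ∈ Icc (0 : ℝ) 1) (hc₂ : 0 < c₂) {s : ℝ}
    (hs : 0 ≤ s) (x : Plane) (θ : ℝ) :
    linkLoss μ α ℓ c₁ c₂ W s x θ ≤
      1 - laplaceTransform μ (fun ω => (W ω : ℝ)) (s * ‖x‖ ^ (-α)) := by
  have hg := pathGain_nonneg α x θ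
  have hgl := pathGain_le hα x θ
  have h : ∀ t, 0 ≤ t → t ≤ s * ‖x‖ ^ (-α) →
      1 - laplaceTransform μ (fun ω => (W ω : ℝ)) t ≤
        1 - laplaceTransform μ (fun ω => (W ω : ℝ)) (s * ‖x‖ ^ (-α)) := fun t ht htu =>
    sub_le_sub_left (laplaceTransform_anti hW.coe_nnreal_real (fun _ => NNReal.coe_nonneg _) ht htu) 1
  have h1 := h (s * pathGain α x θ) (by positivity) (by gcongr)
  have h2 := h (s * ℓ * pathGain α x θ) (mul_nonneg (mul_nonneg hs hℓ.1) hg) (by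
    rw [mul_assoc]
    refine mul_le_mul_of_nonneg_left ?_ hs
    exact (mul_le_of_le_one_left hg hℓ.2).trans hgl)
  have hp := (losProb_pos (c₁ := c₁) hc₂ θ).le
  have hp1 := losProb_le_one (c₁ := c₁) hc₂ θ
  unfold linkLoss
  nlinarith [mul_le_mul_of_nonneg_left h1 hp, mul_le_mul_of_nonneg_left h2 (sub_nonneg.2 hp1)]

lemma linkLoss_lt_one (hW : Measurable W) (hα : 0 ≤ α) (hℓ : ℓ ∈ Icc (0 : ℝ) 1) (hc₂ : 0 < c₂)
    {s : ℝ} (hs : 0 ≤ s) (x : Plane) (θ : ℝ) : linkLoss μ α ℓ c₁ c₂ W s x θ < 1 :=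
  (linkLoss_le μ hW hα hℓ hc₂ hs x θ).trans_lt (sub_lt_self _
    (laplaceTransform_pos hW.coe_nnreal_real (fun _ => NNReal.coe_nonneg _) (by positivity)))

lemma integrable_one_sub_laplaceTransform (hW : Measurable W) (hα : 2 < α)
    (hWi : Integrable (fun ω => (W ω : ℝ) ^ (2 / α)) μ) {s : ℝ} (hs : 0 ≤ s) :
    Integrable (fun x : Plane =>
      1 - laplaceTransform μ (fun ω => (W ω : ℝ)) (s * ‖x‖ ^ (-α))) := by
  have hm : Measurable (fun x : Plane =>
      1 - laplaceTransform μ (fun ω => (W ω : ℝ)) (s * ‖x‖ ^ (-α))) :=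
    measurable_const.sub ((measurable_laplaceTransform hW.coe_nnreal_real).comp (by fun_prop))
  refine ⟨hm.aestronglyMeasurable, ?_⟩
  rw [hasFiniteIntegral_iff_ofReal (ae_of_all _ fun x => sub_nonneg.2
    (laplaceTransform_le_one hW.coe_nnreal_real (fun _ => NNReal.coe_nonneg _) (by positivity))),
    lintegral_one_sub_laplaceTransform hW.coe_nnreal_real (fun _ => NNReal.coe_nonneg _) hα hWi hs]
  exact ENNReal.ofReal_lt_top

lemma integral_one_sub_laplaceTransform (hW : Measurable W) (hα : 2 < α)
    (hWi : Integrable (fun ω => (W ω : ℝ) ^ (2 / α)) μ) {s : ℝ} (hs : 0 ≤ s) :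
    ∫ x : Plane, (1 - laplaceTransform μ (fun ω => (W ω : ℝ)) (s * ‖x‖ ^ (-α))) =
      Real.pi * s ^ (2 / α) * (∫ ω, (W ω : ℝ) ^ (2 / α) ∂μ) * Real.Gamma (1 - 2 / α) := by
  have hG : 0 < Real.Gamma (1 - 2 / α) := Real.Gamma_pos_of_pos (by
    rw [sub_pos, div_lt_one (by linarith)]; exact hα)
  have hE : 0 ≤ ∫ ω, (W ω : ℝ) ^ (2 / α) ∂μ := integral_nonneg fun ω => by positivity
  rw [integral_eq_lintegral_of_nonneg_ae (ae_of_all _ fun x => sub_nonneg.2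
      (laplaceTransform_le_one hW.coe_nnreal_real (fun _ => NNReal.coe_nonneg _) (by positivity)))
    (integrable_one_sub_laplaceTransform μ hW hα hWi hs).aestronglyMeasurable,
    lintegral_one_sub_laplaceTransform hW.coe_nnreal_real (fun _ => NNReal.coe_nonneg _) hα hWi hs,
    ENNReal.toReal_ofReal (by positivity)]

end Shot

/-! ### The Laplace transform and finiteness of the shot signal -/

section Main

variable {Ω : Type*} [mΩ : MeasurableSpace Ω] {μ : Measure Ω} [IsProbabilityMeasure μ]
  {lam : ℝ≥0} {α ℓ c₁ c₂ : ℝ}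
  {X : ℕ → Ω → Plane} {Θ : ℕ → Ω → ℝ} {los : ℕ → Ω → Bool} {W : ℕ → Ω → ℝ≥0}

lemma shotSignal_altitude_eq (hmodel : IsShotModel μ lam c₁ c₂ X Θ los W) (hα : 0 < α)
    (hℓ : 0 ≤ ℓ) :
    ∀ᵐ ω ∂μ, shotSignal α ℓ X (altitude X Θ) los W ω =
      ∑' i, ENNReal.ofReal (W i ω * (channelGain ℓ (los i ω) * pathGain α (X i ω) (Θ i ω))) := by
  filter_upwards [hmodel.ppp.ae_ne_zero, ae_all_iff.2 hmodel.angle_mem] with ω h1 h2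
  refine tsum_congr fun i => ?_
  rw [altitude, spaceNorm_rpow_neg hα (h1 i) (h2 i), ENNReal.ofReal_mul (NNReal.coe_nonneg _),
    ENNReal.ofReal_mul (channelGain_nonneg hℓ _), ENNReal.ofReal_coe_nnreal, mul_assoc]

/-- The weights and the channel factors can be integrated out link by link. -/
lemma integral_prod_link (hmodel : IsShotModel μ lam c₁ c₂ X Θ los W)
    (hℓ : ℓ ∈ Icc (0 : ℝ) 1) (hc₂ : 0 < c₂) {s : ℝ} (hs : 0 ≤ s) (n : ℕ) :
    ∫ ω, ∏ i ∈ Finset.range n, Real.exp (-(s * (W i ω *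
        (channelGain ℓ (los i ω) * pathGain α (X i ω) (Θ i ω))))) ∂μ =
      ∫ ω, ∏ i ∈ Finset.range n,
        (1 - linkLoss μ α ℓ c₁ c₂ (W 0) s (X i ω) (Θ i ω)) ∂μ := by
  have hX := hmodel.ppp.measurable_point
  have hΘ := hmodel.measurable_angle
  have hlos := hmodel.measurable_los
  have hWm := hmodel.measurable_weight
  have hcg : Measurable (channelGain ℓ) := measurable_of_countable _
  have hY : Measurable (fun ω (i : ℕ) => (X i ω, Θ i ω, los i ω)) :=
    measurable_pi_lambda _ fun i => (hX i).prodMk ((hΘ i).prodMk (hlos i))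
  have hLm := measurable_laplaceTransform (μ := μ) (Z := fun ω => (W 0 ω : ℝ))
    (hWm 0).coe_nnreal_real
  -- The weights go first: they are i.i.d. marks independent of all locations and LoS indicators.
  rw [integral_prod_iid_marks hWm hmodel.weight_indep hmodel.weight_ident hY
    hmodel.weight_indep_rest
    (g := fun i w y => Real.exp (-(s * (w * (channelGain ℓ (y i).2.2 *
      pathGain α (y i).1 (y i).2.1)))))]
  rotate_left
  · intro i
    have h1 : Measurable (fun p : ℝ≥0 × (ℕ → Plane × ℝ × Bool) => channelGain ℓ (p.2 i).2.2) :=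
      hcg.comp (by fun_prop)
    have h2 : Measurable (fun p : ℝ≥0 × (ℕ → Plane × ℝ × Bool) =>
        pathGain α (p.2 i).1 (p.2 i).2.1) :=
      Measurable.pathGain α (by fun_prop) (by fun_prop)
    simp only [Function.uncurry_def]
    fun_prop
  · exact fun i w y => (Real.exp_pos _).le
  · intro i w y
    refine Real.exp_le_one_iff.2 (neg_nonpos.2 (mul_nonneg hs (mul_nonneg w.2 (mul_nonneg
      (channelGain_nonneg hℓ.1 _) (pathGain_nonneg _ _ _)))))
  have hm : MeasurableSpace.comap (fun ω (i : ℕ) => (X i ω, Θ i ω)) inferInstance ≤ mΩ :=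
    (measurable_pi_lambda _ fun i => (hX i).prodMk (hΘ i) : Measurable _).comap_le
  have hXΘ : ∀ i, Measurable[MeasurableSpace.comap (fun ω (i : ℕ) => (X i ω, Θ i ω)) inferInstance]
      (fun ω => (X i ω, Θ i ω)) := fun i =>
    (measurable_pi_apply i).comp (comap_measurable (fun ω (i : ℕ) => (X i ω, Θ i ω)))
  have hlap : ∀ t, 0 ≤ t → 0 ≤ laplaceTransform μ (fun ω => (W 0 ω : ℝ)) t ∧
      laplaceTransform μ (fun ω => (W 0 ω : ℝ)) t ≤ 1 := fun t ht =>
    ⟨(laplaceTransform_pos (hWm 0).coe_nnreal_real (fun _ => NNReal.coe_nonneg _) ht).le,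
      laplaceTransform_le_one (hWm 0).coe_nnreal_real (fun _ => NNReal.coe_nonneg _) ht⟩
  have hk1 : ∀ i ω, 0 ≤ s * pathGain α (X i ω) (Θ i ω) := fun i ω =>
    mul_nonneg hs (pathGain_nonneg _ _ _)
  have hk2 : ∀ i ω, 0 ≤ s * ℓ * pathGain α (X i ω) (Θ i ω) := fun i ω =>
    mul_nonneg (mul_nonneg hs hℓ.1) (pathGain_nonneg _ _ _)
  have ha : ∀ i, Measurable[MeasurableSpace.comap (fun ω (i : ℕ) => (X i ω, Θ i ω)) inferInstance]
      (fun ω => laplaceTransform μ (fun ω => (W 0 ω : ℝ)) (s * pathGain α (X i ω) (Θ i ω))) :=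
    fun i => hLm.comp (((hXΘ i).fst.pathGain α (hXΘ i).snd).const_mul s)
  have hb : ∀ i, Measurable[MeasurableSpace.comap (fun ω (i : ℕ) => (X i ω, Θ i ω)) inferInstance]
      (fun ω => laplaceTransform μ (fun ω => (W 0 ω : ℝ)) (s * ℓ * pathGain α (X i ω) (Θ i ω))) :=
    fun i => hLm.comp (((hXΘ i).fst.pathGain α (hXΘ i).snd).const_mul (s * ℓ))
  -- Then the LoS indicators, conditionally on the locations: `a` and `b` are the values of `L_W`
  -- for a LoS link and for a blocked one.
  have key := integral_prod_cond_indep_bool _ hm hlos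
    (p := fun i ω => losProb c₁ c₂ (Θ i ω)) (fun i => (measurable_losProb c₁ c₂).comp (hΘ i))
    (fun i ω => (losProb_pos hc₂ _).le) (fun i ω => losProb_le_one hc₂ _) hmodel.los_cond ha hb
    (fun i ω => (hlap _ (hk1 i ω)).1) (fun i ω => (hlap _ (hk1 i ω)).2)
    (fun i ω => (hlap _ (hk2 i ω)).1) (fun i ω => (hlap _ (hk2 i ω)).2) n
  refine Eq.trans ?_ (key.trans ?_)
  · refine integral_congr_ae (ae_of_all _ fun ω => Finset.prod_congr rfl fun i _ => ?_)
    simp only [channelGain]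
    split_ifs
    · refine integral_congr_ae (ae_of_all _ fun ω' => ?_)
      simp only; congr 1; ring
    · refine integral_congr_ae (ae_of_all _ fun ω' => ?_)
      simp only; congr 1; ring
  · refine integral_congr_ae (ae_of_all _ fun ω => Finset.prod_congr rfl fun i _ => ?_)
    simp only [linkLoss]
    ring

variable {S : Type*} [MeasurableSpace S] {M : ℕ → Ω → S} {τ : Plane → S → ℝ}

/-- The mean loss of a link of projection `x` is measurable in `x`. -/
lemma measurable_integral_linkLoss (hWm : Measurable (W 0)) (hMm : Measurable (M 0))
    (hτ : Measurable (Function.uncurry τ)) (s : ℝ) :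
    Measurable (fun x => ∫ ω, linkLoss μ α ℓ c₁ c₂ (W 0) s x (τ x (M 0 ω)) ∂μ) := by
  have h1 : Measurable (fun p : Plane × Ω => τ p.1 (M 0 p.2)) :=
    hτ.comp (measurable_fst.prodMk (hMm.comp measurable_snd))
  have : StronglyMeasurable (fun p : Plane × Ω =>
      linkLoss μ α ℓ c₁ c₂ (W 0) s p.1 (τ p.1 (M 0 p.2))) :=
    (Measurable.linkLoss μ hWm s measurable_fst h1).stronglyMeasurable
  exact this.integral_prod_right'.measurable

/-- The Laplace transform of the shot signal when the elevation angles are determined by the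
projections and by i.i.d. marks independent of these. -/
theorem shotSignal_laplace_of_marks (hα : 2 < α) (hℓ : ℓ ∈ Icc (0 : ℝ) 1) (hc₂ : 0 < c₂)
    (hmodel : IsShotModel μ lam c₁ c₂ X Θ los W)
    (hWi : Integrable (fun ω => (W 0 ω : ℝ) ^ (2 / α)) μ)
    (hMm : ∀ i, Measurable (M i)) (hM : iIndepFun M μ) (hid : ∀ i, IdentDistrib (M i) (M 0) μ μ)
    (hind : IndepFun (fun ω (i : ℕ) => M i ω) (fun ω (i : ℕ) => X i ω) μ)
    (hτ : Measurable (Function.uncurry τ)) (hΘ : ∀ i, ∀ᵐ ω ∂μ, Θ i ω = τ (X i ω) (M i ω)) :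
    (∀ᵐ ω ∂μ, shotSignal α ℓ X (altitude X Θ) los W ω < ∞) ∧
    ∀ s : ℝ, 0 < s →
      Integrable (fun x => ∫ ω, linkLoss μ α ℓ c₁ c₂ (W 0) s x (τ x (M 0 ω)) ∂μ) ∧
      laplaceTransform μ (fun ω => (shotSignal α ℓ X (altitude X Θ) los W ω).toReal) s =
        Real.exp (-(lam * ∫ x, ∫ ω, linkLoss μ α ℓ c₁ c₂ (W 0) s x (τ x (M 0 ω)) ∂μ)) := by
  have hα0 : 0 < α := by linarith
  have hXm := hmodel.ppp.measurable_point
  have hΘm := hmodel.measurable_angle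
  have hWm := hmodel.measurable_weight
  set u : ℝ → Plane → ℝ := fun s x => ∫ ω, linkLoss μ α ℓ c₁ c₂ (W 0) s x (τ x (M 0 ω)) ∂μ with hu
  set T : Ω → ℝ≥0∞ := fun ω => shotSignal α ℓ X (altitude X Θ) los W ω with hT
  set b : ℝ → Plane → ℝ := fun s x =>
    1 - laplaceTransform μ (fun ω => (W 0 ω : ℝ)) (s * ‖x‖ ^ (-α)) with hb
  have hum : ∀ s, Measurable (u s) := fun s => measurable_integral_linkLoss (hWm 0) (hMm 0) hτ s
  have hlm : ∀ s x, Measurable (fun ω => linkLoss μ α ℓ c₁ c₂ (W 0) s x (τ x (M 0 ω))) :=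
    fun s x => Measurable.linkLoss μ (hWm 0) s measurable_const
      (hτ.comp (measurable_const.prodMk (hMm 0)))
  have hli : ∀ s, 0 < s → ∀ x, Integrable
      (fun ω => linkLoss μ α ℓ c₁ c₂ (W 0) s x (τ x (M 0 ω))) μ := fun s hs x =>
    integrable_of_mem_Icc (hlm s x) (fun ω => linkLoss_nonneg μ (hWm 0) hℓ hc₂ hs.le _ _)
      (fun ω => (linkLoss_lt_one μ (hWm 0) hα0.le hℓ hc₂ hs.le _ _).le)
  have hu0 : ∀ s, 0 < s → ∀ x, 0 ≤ u s x := fun s hs x =>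
    integral_nonneg fun ω => linkLoss_nonneg μ (hWm 0) hℓ hc₂ hs.le _ _
  have hub : ∀ s, 0 < s → ∀ x, u s x ≤ b s x := fun s hs x => by
    have := integral_mono (hli s hs x) (integrable_const (b s x))
      (fun ω => linkLoss_le μ (hWm 0) hα0.le hℓ hc₂ hs.le x _)
    simpa using this
  have hb1 : ∀ s, 0 < s → ∀ x, b s x < 1 := fun s hs x => sub_lt_self _
    (laplaceTransform_pos (hWm 0).coe_nnreal_real (fun _ => NNReal.coe_nonneg _) (by positivity))
  have hbi : ∀ s, 0 < s → Integrable (b s) := fun s hs =>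
    integrable_one_sub_laplaceTransform μ (hWm 0) hα hWi hs.le
  have hui : ∀ s, 0 < s → Integrable (u s) := fun s hs =>
    (hbi s hs).mono' (hum s).aestronglyMeasurable (ae_of_all _ fun x => by
      rw [Real.norm_eq_abs, abs_of_nonneg (hu0 s hs x)]; exact hub s hs x)
  have hTeq := shotSignal_altitude_eq hmodel hα0 hℓ.1
  have hcm : Measurable (channelGain ℓ) := measurable_of_countable _
  have hgm : ∀ i, Measurable (fun ω => (W i ω : ℝ) *
      (channelGain ℓ (los i ω) * pathGain α (X i ω) (Θ i ω))) := fun i =>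
    (hWm i).coe_nnreal_real.mul ((hcm.comp (hmodel.measurable_los i)).mul
      ((hXm i).pathGain α (hΘm i)))
  have hg0 : ∀ i ω, 0 ≤ (W i ω : ℝ) *
      (channelGain ℓ (los i ω) * pathGain α (X i ω) (Θ i ω)) := fun i ω =>
    mul_nonneg (NNReal.coe_nonneg _) (mul_nonneg (channelGain_nonneg hℓ.1 _) (pathGain_nonneg _ _ _))
  have hTm : AEMeasurable T μ :=
    ⟨_, Measurable.tsum fun i => (hgm i).ennreal_ofReal, hTeq⟩
  -- Finiteness of `T` is not yet known, hence `expNeg`. Both sides are identified as the limit of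
  -- the same sequence of expectations of finite products.
  have hlap : ∀ s, 0 < s → ∫ ω, expNeg (ENNReal.ofReal s * T ω) ∂μ =
      Real.exp (-(lam * ∫ x, u s x)) := by
    intro s hs
    have h1 : Tendsto (fun n => ∫ ω, ∏ i ∈ Finset.range n, Real.exp (-(s * (W i ω *
        (channelGain ℓ (los i ω) * pathGain α (X i ω) (Θ i ω))))) ∂μ) atTop
        (𝓝 (∫ ω, expNeg (ENNReal.ofReal s * T ω) ∂μ)) := by
      refine tendsto_integral_of_mem_Icc (fun n => Finset.measurable_prod _ fun i _ =>
        ((hgm i).const_mul s).neg.exp) (fun n ω => Finset.prod_nonneg fun i _ => (Real.exp_pos _).le)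
        (fun n ω => Finset.prod_le_one (fun i _ => (Real.exp_pos _).le) (fun i _ =>
          Real.exp_le_one_iff.2 (neg_nonpos.2 (mul_nonneg hs.le (hg0 i ω))))) ?_
      filter_upwards [hTeq] with ω hω
      have h2 : ∀ i, Real.exp (-(s * (W i ω * (channelGain ℓ (los i ω) *
          pathGain α (X i ω) (Θ i ω))))) = expNeg (ENNReal.ofReal (s * (W i ω *
          (channelGain ℓ (los i ω) * pathGain α (X i ω) (Θ i ω))))) := fun i =>
        (expNeg_ofReal (mul_nonneg hs.le (hg0 i ω))).symm
      simp_rw [h2, ← expNeg_sum]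
      refine (continuous_expNeg.tendsto _).comp ?_
      rw [show T ω = _ from hω, ← ENNReal.tsum_mul_left]
      simp_rw [← ENNReal.ofReal_mul hs.le]
      exact ENNReal.summable.hasSum.tendsto_sum_nat
    have h3 : ∀ n, ∫ ω, ∏ i ∈ Finset.range n, Real.exp (-(s * (W i ω *
        (channelGain ℓ (los i ω) * pathGain α (X i ω) (Θ i ω))))) ∂μ =
        ∫ ω, ∏ i ∈ Finset.range n, (1 - u s (X i ω)) ∂μ := by
      intro n
      rw [integral_prod_link hmodel hℓ hc₂ hs.le n]
      have h4 : ∫ ω, ∏ i ∈ Finset.range n,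
          (1 - linkLoss μ α ℓ c₁ c₂ (W 0) s (X i ω) (Θ i ω)) ∂μ =
          ∫ ω, ∏ i ∈ Finset.range n,
          (1 - linkLoss μ α ℓ c₁ c₂ (W 0) s (X i ω) (τ (X i ω) (M i ω))) ∂μ := by
        refine integral_congr_ae ?_
        filter_upwards [ae_all_iff.2 hΘ] with ω hω
        simp_rw [hω]
      rw [h4, integral_prod_iid_marks hMm hM hid (measurable_pi_lambda _ hXm) hind
        (g := fun i m y => 1 - linkLoss μ α ℓ c₁ c₂ (W 0) s (y i) (τ (y i) m))]
      · refine integral_congr_ae (ae_of_all _ fun ω => Finset.prod_congr rfl fun i _ => ?_)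
        rw [integral_sub (integrable_const _) (hli s hs _)]
        simp [hu]
      · intro i
        have hp : Measurable (fun p : S × (ℕ → Plane) => τ (p.2 i) p.1) :=
          hτ.comp (f := fun p : S × (ℕ → Plane) => (p.2 i, p.1)) (by fun_prop)
        exact measurable_const.sub (Measurable.linkLoss μ (hWm 0) s (by fun_prop) hp)
      · exact fun i m y => sub_nonneg.2 (linkLoss_lt_one μ (hWm 0) hα0.le hℓ hc₂ hs.le _ _).le
      · exact fun i m y => sub_le_self _ (linkLoss_nonneg μ (hWm 0) hℓ hc₂ hs.le _ _)
    refine tendsto_nhds_unique h1 ?_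
    simp_rw [h3]
    exact hmodel.ppp.tendsto_integral_prod (hui s hs) (hum s) (hu0 s hs)
      (fun x => (hub s hs x).trans_lt (hb1 s hs x))
  -- For `s > 0`, `expNeg (s T)` is at most the indicator of `T ≠ ∞`, so the probability of that
  -- event is at least `exp (-λ C s ^ (2 / α))`, which tends to `1` as `s → 0`.
  have hfin : ∀ᵐ ω ∂μ, T ω < ∞ := by
    set C := Real.pi * (∫ ω, (W 0 ω : ℝ) ^ (2 / α) ∂μ) * Real.Gamma (1 - 2 / α) with hC
    have hbC : ∀ s, 0 < s → ∫ x, b s x = C * s ^ (2 / α) := by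
      intro s hs
      rw [integral_one_sub_laplaceTransform μ (hWm 0) hα hWi hs.le, hC]
      ring
    have hle : ∀ s, 0 < s → Real.exp (-(lam * (C * s ^ (2 / α)))) ≤ μ.real {ω | T ω ≠ ∞} := by
      intro s hs
      have hnull : NullMeasurableSet {ω | T ω ≠ ∞} μ :=
        hTm.nullMeasurable (measurableSet_singleton ∞).compl
      calc Real.exp (-(lam * (C * s ^ (2 / α)))) ≤ Real.exp (-(lam * ∫ x, u s x)) := by
            rw [← hbC s hs]
            refine Real.exp_le_exp.2 (neg_le_neg (mul_le_mul_of_nonneg_left ?_ lam.2))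
            exact integral_mono (hui s hs) (hbi s hs) (hub s hs)
        _ = ∫ ω, expNeg (ENNReal.ofReal s * T ω) ∂μ := (hlap s hs).symm
        _ ≤ ∫ ω, {ω | T ω ≠ ∞}.indicator (fun _ => (1 : ℝ)) ω ∂μ := by
            refine integral_mono_of_nonneg (ae_of_all _ fun ω => expNeg_nonneg _)
              ((integrable_const (1 : ℝ)).indicator₀ hnull) (ae_of_all _ fun ω => ?_)
            by_cases hω : T ω = ∞
            · simp [hω, ENNReal.mul_top, hs]
            · have hmem : ω ∈ {ω | T ω ≠ ∞} := hω
              simp only [indicator_of_mem hmem]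
              exact expNeg_le_one _
        _ = μ.real {ω | T ω ≠ ∞} := by
            rw [integral_indicator₀ hnull]; simp
    have hlim : Tendsto (fun s : ℝ => Real.exp (-(lam * (C * s ^ (2 / α))))) (𝓝[>] 0) (𝓝 1) := by
      have hcont : Continuous (fun s : ℝ => Real.exp (-(lam * (C * s ^ (2 / α))))) := by
        have : Continuous (fun s : ℝ => s ^ (2 / α)) := Real.continuous_rpow_const (by positivity)
        fun_prop
      have := hcont.tendsto 0
      rw [Real.zero_rpow (by positivity)] at this
      simp only [mul_zero, neg_zero, Real.exp_zero] at this
      exact this.mono_left nhdsWithin_le_nhds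
    have h1 : 1 ≤ μ.real {ω | T ω ≠ ∞} :=
      le_of_tendsto hlim (by filter_upwards [self_mem_nhdsWithin] with s hs using hle s hs)
    have h2 : μ {ω | T ω ≠ ∞} = 1 := by
      refine le_antisymm prob_le_one ?_
      rw [← ENNReal.ofReal_one, ← ENNReal.ofReal_toReal (measure_ne_top μ {ω | T ω ≠ ∞})]
      exact ENNReal.ofReal_le_ofReal h1
    have h3 : ∀ᵐ ω ∂μ, T ω ≠ ∞ :=
      (prob_compl_eq_zero_iff₀ (hTm.nullMeasurable (measurableSet_singleton ∞).compl)).2 h2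
    filter_upwards [h3] with ω hω using lt_top_iff_ne_top.2 hω
  refine ⟨hfin, fun s hs => ⟨hui s hs, ?_⟩⟩
  rw [← hlap s hs]
  refine integral_congr_ae ?_
  filter_upwards [hfin] with ω hω
  rw [expNeg_of_ne_top (ENNReal.mul_ne_top ENNReal.ofReal_ne_top hω.ne), ENNReal.toReal_mul,
    ENNReal.toReal_ofReal hs.le, neg_mul]

end Main

/-! ### Evaluating the mean loss in the two scenarios -/

section Scenarios

variable {Ω : Type*} [mΩ : MeasurableSpace Ω] {μ : Measure Ω} [IsProbabilityMeasure μ]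
  {α ℓ c₁ c₂ : ℝ} {W : Ω → ℝ≥0}

/-- Scaling: a factor `k` in the argument of `L_W` multiplies the plane integral by `k ^ (2 / α)`,
so `cos ^ α` becomes `cos ^ 2` and `ℓ` becomes `ℓ ^ (2 / α)`. -/
lemma integral_linkLoss_plane (hW : Measurable W) (hα : 2 < α)
    (hWi : Integrable (fun ω => (W ω : ℝ) ^ (2 / α)) μ) (hℓ : 0 ≤ ℓ) {s : ℝ} (hs : 0 < s) (θ : ℝ) :
    ∫ x, linkLoss μ α ℓ c₁ c₂ W s x θ =
      Real.pi * s ^ (2 / α) * (∫ ω, (W ω : ℝ) ^ (2 / α) ∂μ) * Real.Gamma (1 - 2 / α) *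
        (Real.cos (clampAngle θ) ^ 2 *
          (losProb c₁ c₂ θ * (1 - ℓ ^ (2 / α)) + ℓ ^ (2 / α))) := by
  have hc := cos_clampAngle_nonneg θ
  set c := Real.cos (clampAngle θ) with hcdef
  have hcα : 0 ≤ c ^ α := Real.rpow_nonneg hc _
  have hpow : (c ^ α) ^ (2 / α) = c ^ 2 := by
    rw [← Real.rpow_mul hc, mul_div_cancel₀ _ (by linarith : α ≠ 0)]
    exact_mod_cast Real.rpow_natCast c 2
  have h : ∀ x : Plane, linkLoss μ α ℓ c₁ c₂ W s x θ =
      losProb c₁ c₂ θ *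
          (1 - laplaceTransform μ (fun ω => (W ω : ℝ)) (s * c ^ α * ‖x‖ ^ (-α))) +
        (1 - losProb c₁ c₂ θ) *
          (1 - laplaceTransform μ (fun ω => (W ω : ℝ)) (s * ℓ * c ^ α * ‖x‖ ^ (-α))) := by
    intro x
    rw [linkLoss, pathGain, show s * (‖x‖ ^ (-α) * c ^ α) = s * c ^ α * ‖x‖ ^ (-α) by ring,
      show s * ℓ * (‖x‖ ^ (-α) * c ^ α) = s * ℓ * c ^ α * ‖x‖ ^ (-α) by ring]
  have ha1 : 0 ≤ s * c ^ α := by positivity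
  have ha2 : 0 ≤ s * ℓ * c ^ α := by positivity
  simp_rw [h]
  rw [integral_add ((integrable_one_sub_laplaceTransform μ hW hα hWi ha1).const_mul _)
    ((integrable_one_sub_laplaceTransform μ hW hα hWi ha2).const_mul _), integral_const_mul,
    integral_const_mul, integral_one_sub_laplaceTransform μ hW hα hWi ha1,
    integral_one_sub_laplaceTransform μ hW hα hWi ha2, Real.mul_rpow hs.le hcα,
    Real.mul_rpow (by positivity) hcα, Real.mul_rpow hs.le hℓ, hpow]
  ring

lemma integral_integral_linkLoss (hW : Measurable W) (hα : 2 < α)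
    (hWi : Integrable (fun ω => (W ω : ℝ) ^ (2 / α)) μ) (hℓ : ℓ ∈ Icc (0 : ℝ) 1) (hc₂ : 0 < c₂)
    {Θ : Ω → ℝ} (hΘ : Measurable Θ) (hΘm : ∀ᵐ ω ∂μ, Θ ω ∈ Icc 0 (Real.pi / 2))
    {s : ℝ} (hs : 0 < s) :
    ∫ x, ∫ ω, linkLoss μ α ℓ c₁ c₂ W s x (Θ ω) ∂μ =
      Real.pi * s ^ (2 / α) * (∫ ω, (W ω : ℝ) ^ (2 / α) ∂μ) * Real.Gamma (1 - 2 / α) *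
        omegaConst μ α ℓ c₁ c₂ Θ := by
  rw [integral_integral_swap]
  · simp_rw [integral_linkLoss_plane hW hα hWi hℓ.1 hs]
    rw [integral_const_mul, omegaConst]
    congr 1
    refine integral_congr_ae ?_
    filter_upwards [hΘm] with ω hω
    rw [clampAngle_of_mem hω]
  -- Fubini is justified by the majorant of `linkLoss_le`, which is integrable in `x` and constant
  -- in `ω`.
  · refine Integrable.mono'
      ((integrable_one_sub_laplaceTransform μ hW hα hWi hs.le).comp_fst μ)
      (Measurable.linkLoss μ hW s measurable_fst (hΘ.comp measurable_snd)).aestronglyMeasurable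
      (ae_of_all _ fun p => ?_)
    rw [Real.norm_eq_abs, Function.uncurry_def,
      abs_of_nonneg (linkLoss_nonneg μ hW hℓ hc₂ hs.le _ _)]
    exact linkLoss_le μ hW (by linarith) hℓ hc₂ hs.le _ _

lemma arctan_mem_Icc {t : ℝ} (ht : 0 ≤ t) : Real.arctan t ∈ Icc 0 (Real.pi / 2) :=
  ⟨Real.arctan_nonneg.2 ht, (Real.arctan_lt_pi_div_two t).le⟩

lemma measurable_JFun_arctan (hW : Measurable W) {H : Ω → ℝ≥0} (hH : Measurable H) (s : ℝ) :
    Measurable (fun z : ℝ => JFun μ α ℓ c₁ c₂ W (s * z ^ (-(α / 2)))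
      (fun ω => Real.arctan ((H ω : ℝ) / Real.sqrt z))) := by
  have hL := measurable_laplaceTransform (μ := μ) (Z := fun ω => (W ω : ℝ)) hW.coe_nnreal_real
  have hY : Measurable (fun p : ℝ × Ω => Real.arctan ((H p.2 : ℝ) / Real.sqrt p.1)) :=
    Real.measurable_arctan.comp ((hH.comp measurable_snd).coe_nnreal_real.div
      (Real.continuous_sqrt.measurable.comp measurable_fst))
  have hp : Measurable (fun p : ℝ × Ω =>
      losProb c₁ c₂ (Real.arctan ((H p.2 : ℝ) / Real.sqrt p.1))) := (measurable_losProb c₁ c₂).comp hY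
  have hz : Measurable (fun p : ℝ × Ω => s * p.1 ^ (-(α / 2))) := by fun_prop
  have hc : Measurable (fun p : ℝ × Ω =>
      Real.cos (Real.arctan ((H p.2 : ℝ) / Real.sqrt p.1)) ^ α) :=
    (Real.measurable_cos.comp hY).pow_const α
  have h1 := hL.comp (hz.mul hc)
  have h2 := hL.comp ((hz.mul_const ℓ).mul hc)
  have h3 := ((hp.mul (h1.const_sub 1)).add ((hp.const_sub 1).mul (h2.const_sub 1))).stronglyMeasurable
  exact (h3.integral_prod_right' (ν := μ)).measurable

omit [IsProbabilityMeasure μ] in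
-- The right side is written as a function of `‖x‖ ^ 2` alone, the form that the radial integration
-- formulas require.
lemma integral_linkLoss_arctan_eq_JFun (H : Ω → ℝ≥0) (s : ℝ) (x : Plane) :
    ∫ ω, linkLoss μ α ℓ c₁ c₂ W s x (Real.arctan ((H ω : ℝ) / ‖x‖)) ∂μ =
      JFun μ α ℓ c₁ c₂ W (s * (‖x‖ ^ 2) ^ (-(α / 2)))
        (fun ω => Real.arctan ((H ω : ℝ) / Real.sqrt (‖x‖ ^ 2))) := by
  have h1 : (‖x‖ ^ 2) ^ (-(α / 2)) = ‖x‖ ^ (-α) := by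
    rw [← Real.rpow_natCast, ← Real.rpow_mul (norm_nonneg _)]
    congr 1; push_cast; ring
  rw [JFun, Real.sqrt_sq (norm_nonneg _), h1]
  refine integral_congr_ae (ae_of_all _ fun ω => ?_)
  simp only [linkLoss, pathGain]
  rw [clampAngle_of_mem (arctan_mem_Icc (by positivity))]
  congr 4 <;> ring

lemma ofReal_norm_mul_extTan_arctan {x : Plane} (hx : x ≠ 0) (h : ℝ≥0) :
    ENNReal.ofReal ‖x‖ * extTan (Real.arctan ((h : ℝ) / ‖x‖)) = h := by
  have hx0 : 0 < ‖x‖ := norm_pos_iff.2 hx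
  rw [extTan, ← ENNReal.ofReal_div_of_pos (Real.cos_arctan_pos _), ← Real.tan_eq_sin_div_cos,
    Real.tan_arctan, ← ENNReal.ofReal_mul hx0.le, mul_div_cancel₀ _ hx0.ne',
    ENNReal.ofReal_coe_nnreal]

end Scenarios

theorem theorem2 {Ω : Type*} [MeasurableSpace Ω] (μ : Measure Ω) [IsProbabilityMeasure μ]
    (lam : ℝ≥0) (hlam : 0 < lam) (α : ℝ) (hα : 2 < α)
    (ℓ : ℝ) (hℓ : ℓ ∈ Icc (0 : ℝ) 1) (c₁ c₂ : ℝ) (hc₁ : 0 < c₁) (hc₂ : 0 < c₂)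
    (X : ℕ → Ω → Plane) (Θ : ℕ → Ω → ℝ) (los : ℕ → Ω → Bool) (W : ℕ → Ω → ℝ≥0)
    (hmodel : IsShotModel μ lam c₁ c₂ X Θ los W)
    (hW : Integrable (fun ω => (W 0 ω : ℝ) ^ (2 / α)) μ) :
    (IsAPIL μ X Θ →
      (∀ᵐ ω ∂μ, shotSignal α ℓ X (altitude X Θ) los W ω < ∞) ∧
      ∀ s : ℝ, 0 < s →
        laplaceTransform μ (fun ω => (shotSignal α ℓ X (altitude X Θ) los W ω).toReal) s =
          Real.exp (-(Real.pi * lam * s ^ (2 / α) * (∫ ω, (W 0 ω : ℝ) ^ (2 / α) ∂μ) *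
            Real.Gamma (1 - 2 / α) * omegaConst μ α ℓ c₁ c₂ (Θ 0)))) ∧
    (∀ H : ℕ → Ω → ℝ≥0, IsAPDL μ X Θ H →
      (∀ᵐ ω ∂μ, shotSignal α ℓ X (fun i ω => (H i ω : ℝ≥0∞)) los W ω < ∞) ∧
      ∀ s : ℝ, 0 < s →
        IntegrableOn (fun z : ℝ => JFun μ α ℓ c₁ c₂ (W 0) (s * z ^ (-(α / 2)))
          (fun ω => Real.arctan ((H 0 ω : ℝ) / Real.sqrt z))) (Ioi 0) ∧
        laplaceTransform μ
            (fun ω => (shotSignal α ℓ X (fun i ω => (H i ω : ℝ≥0∞)) los W ω).toReal) s =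
          Real.exp (-(Real.pi * lam * ∫ z in Ioi (0 : ℝ),
            JFun μ α ℓ c₁ c₂ (W 0) (s * z ^ (-(α / 2)))
              (fun ω => Real.arctan ((H 0 ω : ℝ) / Real.sqrt z))))) := by
  have hWm := hmodel.measurable_weight 0
  refine ⟨fun h => ?_, fun H h => ?_⟩
  -- Here the marks are the angles and `τ` ignores the projection.
  · obtain ⟨hfin, hlap⟩ := shotSignal_laplace_of_marks hα hℓ hc₂ hmodel hW hmodel.measurable_angle
      h.angle_indep h.angle_ident h.angle_indep_projection (τ := fun _ θ => θ) measurable_snd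
      (fun i => ae_of_all _ fun ω => rfl)
    refine ⟨hfin, fun s hs => ?_⟩
    rw [(hlap s hs).2, integral_integral_linkLoss hWm hα hW hℓ hc₂ (hmodel.measurable_angle 0)
      (hmodel.angle_mem 0) hs]
    congr 1; ring
  · have hτ : Measurable (Function.uncurry fun (x : Plane) (t : ℝ≥0) =>
        Real.arctan ((t : ℝ) / ‖x‖)) :=
      Real.measurable_arctan.comp (measurable_snd.coe_nnreal_real.div measurable_fst.norm)
    -- Here the marks are the altitudes, and `τ` computes the angle from altitude and projection.
    obtain ⟨hfin, hlap⟩ := shotSignal_laplace_of_marks hα hℓ hc₂ hmodel hW h.measurable_altitude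
      h.altitude_indep h.altitude_ident h.altitude_indep_projection hτ h.angle_eq
    -- The altitude recovered from the angle is `H i` except for a projection at the origin, which
    -- almost surely does not occur.
    have heq : ∀ᵐ ω ∂μ, shotSignal α ℓ X (fun i ω => (H i ω : ℝ≥0∞)) los W ω =
        shotSignal α ℓ X (altitude X Θ) los W ω := by
      filter_upwards [hmodel.ppp.ae_ne_zero, ae_all_iff.2 h.angle_eq] with ω h1 h2
      refine tsum_congr fun i => ?_
      rw [altitude, h2 i, ofReal_norm_mul_extTan_arctan (h1 i)]
    refine ⟨by filter_upwards [hfin, heq] with ω h1 h2 using h2 ▸ h1, fun s hs => ?_⟩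
    have hJm := measurable_JFun_arctan (μ := μ) (α := α) (ℓ := ℓ) (c₁ := c₁) (c₂ := c₂) hWm
      (h.measurable_altitude 0) s
    obtain ⟨hint, hl⟩ := hlap s hs
    simp_rw [integral_linkLoss_arctan_eq_JFun] at hint hl
    refine ⟨(integrable_norm_sq_iff hJm).1 hint, ?_⟩
    rw [integral_norm_sq hJm] at hl
    have : laplaceTransform μ
        (fun ω => (shotSignal α ℓ X (fun i ω => (H i ω : ℝ≥0∞)) los W ω).toReal) s =
        laplaceTransform μ (fun ω => (shotSignal α ℓ X (altitude X Θ) los W ω).toReal) s := by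
      refine integral_congr_ae ?_
      filter_upwards [heq] with ω hω
      rw [hω]
    rw [this, hl]
    congr 1; ring
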